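/- **Setting.** Fix an infinite set $\mathbf A$ of attribute names with a distinguished attribute $\mathrm{type}$, a set $\mathbf D$ of data values with a distinguished value $\mathtt{NULL}$, a finite set $\mathbf X$ of variables, and a set $\mathbf T$ of event types with $\mathbf T\subseteq\mathbf D$ and $\mathbf T\subseteq\mathbf X$. Fix $k$ binary operations $\oplus_1,\dots,\oplus_k$ on $\mathbf D$, each making $\mathbf D$ a commutative monoid, with $a\oplus_i\mathtt{NULL}=\mathtt{NULL}$ for all $a,i$. An *event* $e$ is a finite partial map $\mathbf A\rightharpoonup\mathbf D$ with domain $\mathrm{Att}(e)$, together with a time $e(\mathrm{time})\in\mathbb N$; put $e(a)=\mathtt{NULL}$ if $a\notin\mathrm{Att}(e)$. A *renaming* is a finite partial map $r:\mathbf A\rightharpoonup\mathbf A$; $[\![r]\!](e)$ is the event with the time of $e$, with domain $\mathrm{dom}(r)$, and with value $e(r(a))$ at $a$. Fix a set $\mathbf P$ of *predicates* (sets of events) that contains the set of all events, the sets $\{e: e(\mathrm{type})=R\}$ ($R\in\mathbf T$) and $\{e: e(a)=e(b)\}$ ($a,b\in\mathbf A$), and is closed under intersection, complement, and renaming: $P\in\mathbf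 P$ implies $\{e:[\![r]\!](e)\in P\}\in\mathbf P$ for every renaming $r$. A *schema* $\Sigma$ assigns to each type a finite set of attributes. A *stream* over $\Sigma$ is a finite sequence $S=e_1\dots e_n$ of events with $e_i(\mathrm{time})=i$, $e_i(\mathrm{type})\in\mathbf T$, and $\mathrm{Att}(e_i)=\Sigma(e_i(\mathrm{type}))\cup\{\mathrm{type}\}$. A *complex event* is a triple $C=(i,j,\mu)$ with $\mu$ mapping variables to finite bags of events; write $C(X)=\mu(X)$, $\mathrm{start}(C)=i$, $\mathrm{end}(C)=j$. The union $C_1\uplus C_2$ takes the minimum of the starts, the maximum of the ends, and the bag union for each variable. **ACEL.** Formulas are built from event types $R$ by $\varphi\ \mathrm{AS}\ X$, $\varphi\ \mathrm{FILTER}\ X[P]$ ($P\in\mathbf P$), $\pi_L(\varphi)$ ($L\subseteq\mathbf X$), $\varphi\ \mathrm{OR}\ \varphi$, $\varphi\ \mathrm{AND}\ \varphi$, $\varphi:\varphi$, $\varphi;\varphi$, $\varphi\oplus$, $\varphi+$, $\pi_{X(a_1,\dots,a_m)}(\varphi)$, and $\mathtt{Agg}_{Y[b_1\leftarrow\otimes_1X_1(a_1),\dots,b_\ell\leftarrow\otimes_\ell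 X_\ell(a_\ell)]}(\varphi)$ with distinct $b_1,\dots,b_\ell$ and each $\otimes_p$ among $\oplus_1,\dots,\oplus_k$ (single-attribute aggregation is $\ell=1$). The set $[\![\varphi]\!](S)$ of complex events is defined as follows. * $[\![R]\!](S)$: all $(i,i,\mu)$ with $e_i(\mathrm{type})=R$, $\mu(R)=\{\!\!\{e_i\}\!\!\}$ and all other bags empty. * $\mathrm{AS}\ X$: replace $C(X)$ by $\biguplus_{Y\in\mathbf X}C(Y)$. $\mathrm{FILTER}\ X[P]$: keep those $C$ with $C(X)\subseteq P$. $\pi_L$: empty the bags of the variables outside $L$. $\mathrm{OR}$, $\mathrm{AND}$: union and intersection. * $\varphi_1:\varphi_2$ and $\varphi_1;\varphi_2$: all $C_1\uplus C_2$ with $C_1\in[\![\varphi_1]\!](S)$, $C_2\in[\![\varphi_2]\!](S)$, and $\mathrm{end}(C_1)+1=\mathrm{start}(C_2)$, respectively $\mathrm{end}(C_1)<\mathrm{start}(C_2)$. $\varphi\oplus$ and $\varphi+$: the least solutions of $[\![\varphi\oplus]\!]=[\![\varphi]\!]\cup[\![\varphi:\varphi\oplus]\!]$ and $[\![\varphi+]\!]=[\![\varphi]\!]\cup[\![\varphi;\varphi+]\!]$.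 * $\pi_{X(a_1,\dots,a_m)}$: restrict every event of $C(X)$ to the attributes $a_1,\dots,a_m$, keeping its time. * $\mathtt{Agg}$: add to $C(Y)$ one event with time $\mathrm{end}(C)$ and domain $\{b_1,\dots,b_\ell\}$, whose value at $b_p$ is the $\otimes_p$-product of the values $e(a_p)$ over the events $e$ of the bag $C(X_p)$ (the identity of $\otimes_p$ if the bag is empty). **ACEA.** An *expression* is built from constants in $\mathbf D$ and attributes by the operations $\oplus_i$. An *assignment* is a finite partial map $\sigma$ from attributes to expressions; $\mathrm{Att}_{\mathrm{in}}(\sigma)$ is the set of attributes occurring in its expressions, and $[\![\sigma]\!](e)$ is the event with the time of $e$ and domain $\mathrm{dom}(\sigma)$ obtained by evaluating the expressions over $e$. The update $e\gg\nu$ has the time of $e$, equals $e$ on $\mathrm{Att}(e)$, and equals $\nu$ on $\mathrm{Att}(\nu)\setminus\mathrm{Att}(e)$. An ACEA $\mathcal A=(Q,\Delta,q_0,F)$ has a finite state set $Q$, an initial state $q_0$, final states $F\subseteq Q$, and a finite set $\Delta$ of transitions $(p,\sigma,P,\lambda,q)$ with $p,q\in Q$, $\sigma$ an assignment, $P\in\mathbf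 P$, and $\lambda$ mapping variables to finite bags of renamings whose values lie in $\mathrm{dom}(\sigma)$. An accepting run over $S$ from $i$ to $j$ ($1\le i\le j\le n$) is a sequence of configurations $(q_k,\nu_k)$, $i\le k\le j+1$, and transitions $(q_k,\sigma_k,P_k,\lambda_k,q_{k+1})\in\Delta$, $i\le k\le j$, with $q_i=q_0$, $\mathrm{Att}(\nu_i)=\emptyset$, $\mathrm{Att}_{\mathrm{in}}(\sigma_k)\subseteq\mathrm{Att}(e_k\gg\nu_k)$, $\nu_{k+1}=[\![\sigma_k]\!](e_k\gg\nu_k)\in P_k$, and $q_{j+1}\in F$. It yields the complex event $(i,j,\mu)$ in which $\mu(X)$ is the bag of the events $[\![r]\!](\nu_{k+1})$ with time $k$, for $i\le k\le j$ and $r\in\lambda_k(X)$. $[\![\mathcal A]\!](S)$ is the set of the complex events of all accepting runs of $\mathcal A$ over $S$. **Theorem.** Let $\Sigma$ be a schema. For every ACEL formula $\varphi$ there is an ACEA $\mathcal A_\varphi$ such that $[\![\varphi]\!](S)=[\![\mathcal A_\varphi]\!](S)$ for every stream $S$ over $\Sigma$. -/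

import Mathlib

/-! ### Finite mappings and events -/

/-- A mapping `α ⇀ β`: a partial function with finite domain. -/
@[ext]
structure PMap (α β : Type*) where
  toFun : α → Option β
  finite_dom : {a | (toFun a).isSome}.Finite

namespace PMap

variable {α β γ : Type*}

instance : CoeFun (PMap α β) (fun _ => α → Option β) := ⟨toFun⟩

/-- The domain of a mapping. -/
def dom (p : PMap α β) : Set α := {a | (p a).isSome}

/-- The mapping with empty domain. -/
def empty : PMap α β := ⟨fun _ => none, by simp⟩

/-- Postcomposition with a function; the domain does not change. -/
def map (f : β → γ) (p : PMap α β) : PMap α γ :=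
  ⟨fun a => (p a).map f, by simpa using p.finite_dom⟩

open Classical in
/-- Restriction to the part of the domain that lies in `s`. -/
noncomputable def restrict (p : PMap α β) (s : Set α) : PMap α β :=
  ⟨fun a => if a ∈ s then p a else none, p.finite_dom.subset (by
    intro a ha
    by_cases h : a ∈ s <;> simp_all)⟩

/-- `p.extend p'` is defined on the union of both domains and agrees with `p` where `p` is defined,
with `p'` elsewhere. -/
def extend (p p' : PMap α β) : PMap α β :=
  ⟨fun a => (p a).or (p' a), (p.finite_dom.union p'.finite_dom).subset (by
    intro a ha
    simpa using ha)⟩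

end PMap

/-- An event: a mapping from attribute names to data values, together with its time. -/
@[ext]
structure Event (A D : Type*) where
  data : PMap A D
  time : ℕ

/-- The set of attributes on which an event is defined. -/
def Event.att {A D : Type*} (e : Event A D) : Set A := e.data.dom

/-- The update `e ≫ e'` of `e'` by `e`; it takes place at the time of `e`. -/
def Event.update {A D : Type*} (e e' : Event A D) : Event A D :=
  ⟨e.data.extend e'.data, e.time⟩

/-- The projection of an event to the attributes in `s`. -/
noncomputable def Event.proj {A D : Type*} (e : Event A D) (s : Finset A) : Event A D :=
  ⟨e.data.restrict s, e.time⟩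

/-- A renaming: a mapping from attribute names to attribute names. -/
abbrev Renaming (A : Type*) := PMap A A

/-- The fixed data over attribute names `A`, data values `D`, event types `T` and variables `X`:
the attribute `type`, the inclusions of the event types into the data values and into the
variables, the value `NULL`, and `k` commutative monoids on `D` for which `NULL` is absorbing. -/
structure Setting (A D T X : Type*) (k : ℕ) where
  typeAttr : A
  tyVal : T ↪ D
  tyVar : T ↪ X
  null : D
  monoid : Fin k → CommMonoid D
  mul_null : ∀ i a, (monoid i).mul a null = null

/-- `(D, A)`-expressions: constants, attributes, and applications of the `k` operations. -/
inductive AExpr (A D : Type*) (k : ℕ) where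
  | const (d : D)
  | attr (a : A)
  | op (i : Fin k) (α β : AExpr A D k)

/-- The attributes that occur in an expression. -/
def AExpr.att {A D : Type*} {k : ℕ} : AExpr A D k → Set A
  | .const _ => ∅
  | .attr a => {a}
  | .op _ α β => α.att ∪ β.att

/-- An assignment: a mapping from attribute names to expressions. -/
abbrev Assignment (A D : Type*) (k : ℕ) := PMap A (AExpr A D k)

/-- The attributes read by an assignment. -/
def Assignment.attIn {A D : Type*} {k : ℕ} (σ : Assignment A D k) : Set A :=
  {a | ∃ b α, σ b = some α ∧ a ∈ α.att}

namespace Setting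

variable {A D T X : Type*} {k : ℕ} (𝒮 : Setting A D T X k)

/-- The value `e(a)`, which is `NULL` if `e` is not defined on `a`. -/
def val (e : Event A D) (a : A) : D := (e.data a).getD 𝒮.null

/-- The value of an expression over an event. -/
def eval (e : Event A D) : AExpr A D k → D
  | .const d => d
  | .attr a => 𝒮.val e a
  | .op i α β => (𝒮.monoid i).mul (eval e α) (eval e β)

/-- The event `⟦σ⟧(e)`: the attribute `a` gets the value of the expression `σ(a)` over `e`. -/
def assign (σ : Assignment A D k) (e : Event A D) : Event A D :=
  ⟨σ.map (𝒮.eval e), e.time⟩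

/-- The event `⟦r⟧(e)`, a renaming being read as an assignment: its attributes are those in the
domain of `r`, and the attribute `a` gets the value `e(r(a))`. -/
def rename (r : Renaming A) (e : Event A D) : Event A D :=
  ⟨r.map (𝒮.val e), e.time⟩

/-- Admissible sets of predicates: they contain the set of all events, the tests `type = R` for
the event types and the tests `a = b` for attributes, and are closed under intersection,
complement, and renaming (testing `P` after the renaming `r`). -/
structure IsPredicateFamily (Preds : Set (Set (Event A D))) : Prop where
  univ_mem : Set.univ ∈ Preds
  inter_mem : ∀ P₁ ∈ Preds, ∀ P₂ ∈ Preds, P₁ ∩ P₂ ∈ Preds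
  compl_mem : ∀ P ∈ Preds, Pᶜ ∈ Preds
  rename_mem : ∀ P ∈ Preds, ∀ r : Renaming A, {e | 𝒮.rename r e ∈ P} ∈ Preds
  type_mem : ∀ R : T, {e | 𝒮.val e 𝒮.typeAttr = 𝒮.tyVal R} ∈ Preds
  eq_mem : ∀ a b : A, {e | 𝒮.val e a = 𝒮.val e b} ∈ Preds

end Setting

/-! ### Streams and complex events -/

/-- `e` is the event at position `i` of the sequence `S = e₁ e₂ … eₙ`; positions start at 1. -/
def EventAt {A D : Type*} (S : List (Event A D)) (i : ℕ) (e : Event A D) : Prop :=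
  1 ≤ i ∧ S[i - 1]? = some e

/-- An event satisfies a schema if it is typed and has exactly the attributes that the schema
gives to its type, and the attribute `type`. -/
def Setting.Satisfies {A D T X : Type*} {k : ℕ} (𝒮 : Setting A D T X k) (Sch : T → Finset A)
    (e : Event A D) : Prop :=
  ∃ R : T, e.data 𝒮.typeAttr = some (𝒮.tyVal R) ∧ e.att = ↑(Sch R) ∪ {𝒮.typeAttr}

/-- A stream over a schema: a finite sequence of events that satisfy the schema, in which the time
of every event is its position. -/
def Setting.IsStream {A D T X : Type*} {k : ℕ} (𝒮 : Setting A D T X k) (Sch : T → Finset A)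
    (S : List (Event A D)) : Prop :=
  ∀ i e, EventAt S i e → 𝒮.Satisfies Sch e ∧ e.time = i

/-- A complex event `(i, j, μ)`, where `μ` maps variables to finite bags of events. -/
@[ext]
structure ComplexEvent (A D X : Type*) where
  start : ℕ
  finish : ℕ
  bag : X → Multiset (Event A D)

/-- The union of two complex events. -/
def ComplexEvent.union {A D X : Type*} (C₁ C₂ : ComplexEvent A D X) : ComplexEvent A D X :=
  ⟨min C₁.start C₂.start, max C₁.finish C₂.finish, fun Z => C₁.bag Z + C₂.bag Z⟩

/-- The iteration of a set `𝒞` of complex events: the least set that contains `𝒞` and all unions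
of some `C₁ ∈ 𝒞` with some `C₂` of the iteration such that `link C₁ C₂`. -/
inductive ComplexEvent.Iter {A D X : Type*}
    (link : ComplexEvent A D X → ComplexEvent A D X → Prop) (𝒞 : Set (ComplexEvent A D X)) :
    ComplexEvent A D X → Prop
  | base {C} (h : C ∈ 𝒞) : Iter link 𝒞 C
  | step {C₁ C₂} (h₁ : C₁ ∈ 𝒞) (h₂ : Iter link 𝒞 C₂) (h : link C₁ C₂) :
      Iter link 𝒞 (C₁.union C₂)

/-! ### Aggregation complex event logic -/

/-- ACEL formulas with predicates from `Preds`. In `agg Y s φ` the mapping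
`s = [b₁ ↦ (⊗₁, X₁, a₁), …, bₗ ↦ (⊗ₗ, Xₗ, aₗ)]` stands for the subscript
`Y[b₁ ← ⊗₁ X₁(a₁), …, bₗ ← ⊗ₗ Xₗ(aₗ)]`; the single-attribute aggregation is the case of a
one-element domain. -/
inductive ACEL (A D T X : Type*) (k : ℕ) (Preds : Set (Set (Event A D))) where
  /-- event type selection `R` -/
  | ty (R : T)
  /-- variable binding `φ AS Z` -/
  | as (φ : ACEL A D T X k Preds) (Z : X)
  /-- predicate filtering `φ FILTER Z[P]` -/
  | filter (φ : ACEL A D T X k Preds) (Z : X) (P : Preds)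
  /-- variable projection -/
  | proj (L : Set X) (φ : ACEL A D T X k Preds)
  /-- disjunction -/
  | or (φ₁ φ₂ : ACEL A D T X k Preds)
  /-- conjunction -/
  | and (φ₁ φ₂ : ACEL A D T X k Preds)
  /-- contiguous sequencing `φ₁ : φ₂` -/
  | cseq (φ₁ φ₂ : ACEL A D T X k Preds)
  /-- non-contiguous sequencing `φ₁ ; φ₂` -/
  | seq (φ₁ φ₂ : ACEL A D T X k Preds)
  /-- contiguous iteration `φ ⊕` -/
  | citer (φ : ACEL A D T X k Preds)
  /-- non-contiguous iteration `φ +` -/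
  | iter (φ : ACEL A D T X k Preds)
  /-- attribute projection, which keeps the attributes in `s` of the events in the variable `Z` -/
  | attProj (Z : X) (s : Finset A) (φ : ACEL A D T X k Preds)
  /-- (multi-attribute) aggregation -/
  | agg (Y : X) (s : PMap A (Fin k × X × A)) (φ : ACEL A D T X k Preds)

namespace Setting

variable {A D T X : Type*} {k : ℕ} (𝒮 : Setting A D T X k)

/-- The aggregate of the values `e(a)` over the events `e` of a bag, in the `i`-th monoid. -/
def aggregate (i : Fin k) (B : Multiset (Event A D)) (a : A) : D :=
  letI := 𝒮.monoid i
  (B.map fun e => 𝒮.val e a).prod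

/-- The event that an aggregation with subscript `s` creates from the complex event `C`. -/
def aggEvent (s : PMap A (Fin k × X × A)) (C : ComplexEvent A D X) : Event A D :=
  ⟨s.map fun x => 𝒮.aggregate x.1 (C.bag x.2.1) x.2.2, C.finish⟩

/-- The set `⟦φ⟧(S)` of complex events defined by an ACEL formula over a stream. -/
def sem [Fintype X] {Preds : Set (Set (Event A D))} (S : List (Event A D)) :
    ACEL A D T X k Preds → Set (ComplexEvent A D X)
  | .ty R => {C | ∃ e, EventAt S C.start e ∧ C.finish = C.start ∧
      𝒮.val e 𝒮.typeAttr = 𝒮.tyVal R ∧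
      C.bag (𝒮.tyVar R) = {e} ∧ ∀ Z, Z ≠ 𝒮.tyVar R → C.bag Z = 0}
  | .as φ Y => {C | ∃ C' ∈ sem S φ, C.start = C'.start ∧ C.finish = C'.finish ∧
      C.bag Y = ∑ Z, C'.bag Z ∧ ∀ Z, Z ≠ Y → C.bag Z = C'.bag Z}
  | .filter φ Y P => {C | C ∈ sem S φ ∧ ∀ e ∈ C.bag Y, e ∈ P.1}
  | .proj L φ => {C | ∃ C' ∈ sem S φ, C.start = C'.start ∧ C.finish = C'.finish ∧
      (∀ Z, Z ∈ L → C.bag Z = C'.bag Z) ∧ ∀ Z, Z ∉ L → C.bag Z = 0}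
  | .or φ₁ φ₂ => sem S φ₁ ∪ sem S φ₂
  | .and φ₁ φ₂ => sem S φ₁ ∩ sem S φ₂
  | .cseq φ₁ φ₂ => {C | ∃ C₁ ∈ sem S φ₁, ∃ C₂ ∈ sem S φ₂,
      C₁.finish + 1 = C₂.start ∧ C = C₁.union C₂}
  | .seq φ₁ φ₂ => {C | ∃ C₁ ∈ sem S φ₁, ∃ C₂ ∈ sem S φ₂,
      C₁.finish < C₂.start ∧ C = C₁.union C₂}
  | .citer φ => {C | ComplexEvent.Iter (fun C₁ C₂ => C₁.finish + 1 = C₂.start) (sem S φ) C}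
  | .iter φ => {C | ComplexEvent.Iter (fun C₁ C₂ => C₁.finish < C₂.start) (sem S φ) C}
  | .attProj Y s φ => {C | ∃ C' ∈ sem S φ, C.start = C'.start ∧ C.finish = C'.finish ∧
      C.bag Y = (C'.bag Y).map (fun e => e.proj s) ∧ ∀ Z, Z ≠ Y → C.bag Z = C'.bag Z}
  | .agg Y s φ => {C | ∃ C' ∈ sem S φ, C.start = C'.start ∧ C.finish = C'.finish ∧
      C.bag Y = C'.bag Y + {𝒮.aggEvent s C'} ∧ ∀ Z, Z ≠ Y → C.bag Z = C'.bag Z}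

end Setting

/-! ### Aggregation complex event automata -/

/-- A transition `(p, σ, P, λ, q)`. The partial mapping `λ` is given as a total one: a variable
outside its domain gets the empty bag of renamings. -/
structure Transition (A D X : Type*) (k : ℕ) (Preds : Set (Set (Event A D))) (Q : Type) where
  src : Q
  asg : Assignment A D k
  pred : Preds
  out : X → Multiset (Renaming A)
  dst : Q

/-- Aggregation complex event automata with predicates from `Preds`. -/
structure ACEA (A D X : Type*) (k : ℕ) (Preds : Set (Set (Event A D))) where
  State : Type
  finite_state : Finite State
  trans : Set (Transition A D X k Preds State)
  finite_trans : trans.Finite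
  initial : State
  final : Set State
  /-- the renamings of a transition read only registers that its assignment defines -/
  consistent : ∀ t ∈ trans, ∀ Z, ∀ r ∈ t.out Z, ∀ a b, r a = some b → b ∈ t.asg.dom

namespace Setting

variable {A D T X : Type*} {k : ℕ} (𝒮 : Setting A D T X k)

/-- `Run 𝒜 S i j q ν μ`: some run of `𝒜` over `S` that starts at position `i` has read the
positions from `i` up to, but not including, `j`, has reached the configuration `(q, ν)`, and its
transitions have produced the bags of events `μ`. -/
inductive Run {Preds : Set (Set (Event A D))} (𝒜 : ACEA A D X k Preds) (S : List (Event A D)) (i : ℕ) :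
    ℕ → 𝒜.State → Event A D → (X → Multiset (Event A D)) → Prop
  | start : Run 𝒜 S i i 𝒜.initial ⟨PMap.empty, 0⟩ (fun _ => 0)
  | step {j : ℕ} {ν e : Event A D} {μ : X → Multiset (Event A D)}
      {t : Transition A D X k Preds 𝒜.State}
      (prev : Run 𝒜 S i j t.src ν μ)
      (ht : t ∈ 𝒜.trans)
      (he : EventAt S j e)
      (hin : Assignment.attIn t.asg ⊆ (e.update ν).att)
      (hpred : 𝒮.assign t.asg (e.update ν) ∈ t.pred.1) :
      Run 𝒜 S i (j + 1) t.dst (𝒮.assign t.asg (e.update ν))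
        (fun Z => μ Z +
          (t.out Z).map fun r => ⟨(𝒮.rename r (𝒮.assign t.asg (e.update ν))).data, j⟩)

/-- The set `⟦𝒜⟧(S)` of the complex events defined by the accepting runs of `𝒜` over `S`; a run
from position `i` to position `j` reads all positions `i, …, j`, and `i ≤ j`. -/
def accepted {Preds : Set (Set (Event A D))} (𝒜 : ACEA A D X k Preds) (S : List (Event A D)) :
    Set (ComplexEvent A D X) :=
  {C | C.start ≤ C.finish ∧ ∃ q ∈ 𝒜.final, ∃ ν, 𝒮.Run 𝒜 S C.start (C.finish + 1) q ν C.bag}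

end Setting

/-! Automata are replaced by machines, which are easier to combine. A machine has finitely many
registers, all defined from the outset, and finitely many instructions; its control is a regular
language of words of instructions rather than a state graph. An instruction computes new register
values by expressions in the old values and the input, tests the new values, and emits renamed
copies of them. By induction on the formula every formula is defined by a machine, and
`Definable.exists_acea` turns machines into automata.

Sequencing and iteration become concatenation and star. In `Definable.link` two machines use
disjoint registers, in `Definable.iter` the head of each block resets the registers, and gaps are
filled with an instruction that does nothing. The remaining operations act position by position,
because the bags of a run are sums of what single positions emit. Bindings and projections change
what instructions emit, and a filter tests events as they are emitted. For a conjunction two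
machines run in lockstep: an emitted event carries the time of its position, so the total bags agree
iff the bags emitted at each position agree, and this is a Boolean combination of equalities of
registers. For an aggregation additional registers accumulate the products, and the last
instruction, which is marked in the language, emits them.

In an automaton the registers become attributes foreign to the schema; they exist because `A` is
infinite and finitely many types use finitely many attributes. Two obstacles remain. An assignment
may read only defined attributes, so a transition guesses the type of the input, which determines
its attributes, and writes `NULL` for all others. Since predicates see only the new registers, the
guess is checked on a copy of the type kept in one more register. Moreover no register is defined at
the start, so a separate initial state uses the initial values as constants. -/

open scoped Computability

universe u

/-! ### Closure properties of regular languages -/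

namespace Language

variable {α β : Type*}

/-- The words whose image under a map of the letters lies in a language. -/
def comap (f : α → β) (L : Language β) : Language α := {w | w.map f ∈ L}

theorem mem_comap {f : α → β} {L : Language β} {w : List α} : w ∈ comap f L ↔ w.map f ∈ L :=
  Iff.rfl

theorem IsRegular.comap {L : Language β} (h : L.IsRegular) (f : α → β) :
    (Language.comap f L).IsRegular := by
  obtain ⟨σ, _, M, rfl⟩ := h
  exact ⟨σ, inferInstance, M.comap f, M.accepts_comap f⟩

/-- By Myhill–Nerode, finitely many left quotients suffice. For a word `y` with `x ++ y ∈ L * M`,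
the cut lies in `y` or splits `x = u ++ v` with `u ∈ L`. So the quotient by `x` is determined by one
quotient of `L` and a set of quotients of `M`. -/
theorem IsRegular.mul {L M : Language α} (hL : L.IsRegular) (hM : M.IsRegular) :
    (L * M).IsRegular := by
  refine .of_finite_range_leftQuotient ?_
  refine ((hL.finite_range_leftQuotient.prod
    hM.finite_range_leftQuotient.powerset).image
      fun p : Language α × Set (Language α) => p.1 * M + ⨆ N : p.2, N.1).subset ?_
  rintro _ ⟨x, rfl⟩
  refine ⟨⟨L.leftQuotient x, {N | ∃ u ∈ L, ∃ v, u ++ v = x ∧ N = M.leftQuotient v}⟩,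
    ⟨⟨x, rfl⟩, ?_⟩, ?_⟩
  · rintro _ ⟨u, -, v, -, rfl⟩
    exact ⟨v, rfl⟩
  · ext y
    simp only [mem_add, mem_mul, mem_iSup, mem_leftQuotient]
    constructor
    · rintro (⟨c, hc, b, hb, rfl⟩ | ⟨⟨_, u, hu, v, rfl, rfl⟩, hN⟩)
      · exact ⟨x ++ c, hc, b, hb, by simp⟩
      · exact ⟨u, hu, v ++ y, hN, by simp⟩
    · rintro ⟨a, ha, b, hb, h⟩
      rcases List.append_eq_append_iff.1 h with ⟨c, rfl, rfl⟩ | ⟨c, rfl, rfl⟩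
      · exact Or.inr ⟨⟨_, a, ha, c, rfl, rfl⟩, hb⟩
      · exact Or.inl ⟨c, ha, b, hb, rfl⟩

/-- The prefix `x` ends inside some factor or at its end: `v` is the part of this factor that lies
in `x`, and `p` is the rest. That `x` is nonempty guarantees such a factor. -/
theorem exists_split_of_append_mem_kstar {L : Language α} {y : List α} (l : List (List α))
    (hl : ∀ z ∈ l, z ∈ L) (x : List α) (hx : x ≠ []) (h : x ++ y = l.flatten) :
    ∃ u ∈ L∗, ∃ v, u ++ v = x ∧ ∃ p q, v ++ p ∈ L ∧ q ∈ L∗ ∧ p ++ q = y := by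
  induction l generalizing x with
  | nil => simp_all
  | cons z l ih =>
    rw [List.flatten_cons] at h
    have hl' : ∀ z ∈ l, z ∈ L := fun z hz => hl z (List.mem_cons_of_mem _ hz)
    have hz : z ∈ L := hl z List.mem_cons_self
    rcases List.append_eq_append_iff.1 h with ⟨c, rfl, rfl⟩ | ⟨c, rfl, hc⟩
    · exact ⟨[], nil_mem_kstar L, x, rfl, c, _, hz, join_mem_kstar hl', rfl⟩
    -- Here `x = z ++ c`. If `c` is empty, `x` ends together with the factor `z`, and the induction
    -- hypothesis, which needs a nonempty prefix, is not available.
    · by_cases h0 : c = []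
      · subst h0
        exact ⟨[], nil_mem_kstar L, z, by simp, [], y, by simpa using hz,
          (show l.flatten = y from hc) ▸ join_mem_kstar hl', rfl⟩
      · obtain ⟨u, hu, v, rfl, p, q, h1, h2, h3⟩ := ih hl' c h0 hc.symm
        refine ⟨z ++ u, ?_, v, by simp, p, q, h1, h2, h3⟩
        rw [← one_add_self_mul_kstar_eq_kstar, mem_add]
        exact Or.inr (append_mem_mul hz hu)

theorem append_mem_kstar {L : Language α} {u v : List α} (hu : u ∈ L∗) (hv : v ∈ L∗) :
    u ++ v ∈ L∗ := by
  obtain ⟨l, rfl, hl⟩ := mem_kstar.1 hu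
  obtain ⟨m, rfl, hm⟩ := mem_kstar.1 hv
  refine mem_kstar.2 ⟨l ++ m, by simp, ?_⟩
  intro y hy
  rcases List.mem_append.1 hy with h | h
  exacts [hl y h, hm y h]

theorem mem_kstar_of_mem {L : Language α} {u : List α} (hu : u ∈ L) : u ∈ L∗ :=
  mem_kstar.2 ⟨[u], by simp, by simpa using hu⟩

/-- For nonempty `x` the quotient of `L∗` is a union of quotients `v⁻¹L`, over the splittings `x = u
++ v` with `u ∈ L∗`, times `L∗`. The empty `x` contributes `L∗` itself. -/
theorem IsRegular.kstar {L : Language α} (hL : L.IsRegular) : (L∗).IsRegular := by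
  refine .of_finite_range_leftQuotient ?_
  refine ((hL.finite_range_leftQuotient.powerset.image
      fun p : Set (Language α) => (⨆ N : p, N.1) * L∗).insert (L∗)).subset ?_
  rintro _ ⟨x, rfl⟩
  by_cases hx : x = []
  · subst hx
    exact Or.inl rfl
  refine Or.inr ⟨{N | ∃ u ∈ L∗, ∃ v, u ++ v = x ∧ N = L.leftQuotient v}, ?_, ?_⟩
  · rintro _ ⟨u, -, v, -, rfl⟩
    exact ⟨v, rfl⟩
  · ext y
    simp only [mem_mul, mem_iSup, mem_leftQuotient]
    constructor
    · rintro ⟨p, ⟨⟨_, u, hu, v, rfl, rfl⟩, hp⟩, q, hq, rfl⟩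
      have := append_mem_kstar hu (append_mem_kstar (mem_kstar_of_mem hp) hq)
      simpa using this
    · intro h
      obtain ⟨l, hl, hl'⟩ := mem_kstar.1 h
      obtain ⟨u, hu, v, rfl, p, q, h1, h2, rfl⟩ := exists_split_of_append_mem_kstar l hl' x hx hl
      exact ⟨p, ⟨⟨_, u, hu, v, rfl, rfl⟩, h1⟩, q, h2, rfl⟩

theorem mem_map_iff {L : Language α} {f : α → β} {w : List β} :
    w ∈ Language.map f L ↔ ∃ v ∈ L, v.map f = w := Iff.rfl

/-- The quotient of the image by `x` is the union of the images of the quotients of `L` by the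
preimages of `x`. -/
theorem IsRegular.map {L : Language α} (hL : L.IsRegular) (f : α → β) :
    (Language.map f L).IsRegular := by
  refine .of_finite_range_leftQuotient ?_
  refine (hL.finite_range_leftQuotient.powerset.image
      fun p : Set (Language α) => ⨆ N : p, Language.map f N.1).subset ?_
  rintro _ ⟨x, rfl⟩
  refine ⟨{N | ∃ v, v.map f = x ∧ N = L.leftQuotient v}, ?_, ?_⟩
  · rintro _ ⟨v, -, rfl⟩
    exact ⟨v, rfl⟩
  · ext y
    simp only [mem_iSup, mem_leftQuotient, mem_map_iff]
    constructor
    · rintro ⟨⟨_, v, rfl, rfl⟩, w, hw, rfl⟩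
      exact ⟨v ++ w, hw, by simp⟩
    · rintro ⟨w, hw, h⟩
      obtain ⟨u, v, rfl, rfl, rfl⟩ := List.map_eq_append_iff.1 h
      exact ⟨⟨_, u, rfl, rfl⟩, v, hw, rfl⟩

theorem mem_singleton_iff {x w : List α} : w ∈ ({x} : Language α) ↔ w = x := Iff.rfl

theorem isRegular_letter (a : α) : IsRegular ({[a]} : Language α) := by
  refine .of_finite_range_leftQuotient ((Set.toFinite {({[a]} : Language α), 1, 0}).subset ?_)
  rintro _ ⟨x, rfl⟩
  rcases x with _ | ⟨b, _ | ⟨c, x⟩⟩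
  · exact Or.inl rfl
  · by_cases h : b = a
    · refine Or.inr (Or.inl ?_)
      ext y
      simp [mem_singleton_iff, h]
    · refine Or.inr (Or.inr ?_)
      ext y
      simp [mem_singleton_iff, h, notMem_zero]
  · refine Or.inr (Or.inr ?_)
    ext y
    simp [mem_singleton_iff, notMem_zero]

theorem isRegular_one : (1 : Language α).IsRegular := by
  refine .of_finite_range_leftQuotient ((Set.toFinite {(1 : Language α), 0}).subset ?_)
  rintro _ ⟨x, rfl⟩
  rcases x with _ | ⟨b, x⟩
  · exact Or.inl rfl
  · refine Or.inr ?_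
    ext y
    simp [mem_one, notMem_zero]

theorem mem_kstar_letter {a : α} {w : List α} :
    w ∈ ({[a]} : Language α)∗ ↔ ∃ m, w = List.replicate m a := by
  rw [mem_kstar]
  constructor
  · rintro ⟨l, rfl, hl⟩
    refine ⟨l.flatten.length, List.eq_replicate_iff.2 ⟨rfl, ?_⟩⟩
    intro b hb
    obtain ⟨z, hz, hb⟩ := List.mem_flatten.1 hb
    have := hl z hz
    rw [mem_singleton_iff] at this
    simpa [this] using hb
  · rintro ⟨m, rfl⟩
    refine ⟨List.replicate m [a], by simp, ?_⟩
    intro y hy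
    exact (List.mem_replicate.1 hy).2

end Language

/-- Marks the first letter of a word. -/
def List.markHead {α : Type*} : List α → List (α × Bool)
  | [] => []
  | a :: v => (a, true) :: v.map (·, false)

theorem List.eq_map_pair_of_snd_eq_replicate {α β : Type*} {b : β} :
    ∀ {v : List (α × β)} {m : ℕ}, v.map Prod.snd = List.replicate m b →
      v = (v.map Prod.fst).map (·, b)
  | [], _, _ => rfl
  | (a, c) :: v, m, h => by
    cases m with
    | zero => simp at h
    | succ m =>
      rw [List.map_cons, List.replicate_succ, List.cons.injEq] at h
      obtain ⟨rfl, h⟩ := h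
      rw [List.map_cons, List.map_cons, ← eq_map_pair_of_snd_eq_replicate h]

/-! ### Regularity of languages with a marked first or last letter -/

namespace Language

variable {α : Type*}

/-- The words of a language with the first letter marked. -/
def markHead (L : Language α) : Language (α × Bool) :=
  {w | ∃ v ∈ L, w = v.markHead}

/-- The words of a language with the last letter marked. -/
def markLast (L : Language α) : Language (α × Bool) :=
  {w | ∃ v a, v ++ [a] ∈ L ∧ w = v.map (·, false) ++ [(a, true)]}

theorem mem_markHead {L : Language α} {w : List (α × Bool)} :
    w ∈ L.markHead ↔ ∃ v ∈ L, w = v.markHead := Iff.rfl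

theorem mem_markLast {L : Language α} {w : List (α × Bool)} :
    w ∈ L.markLast ↔ ∃ v a, v ++ [a] ∈ L ∧ w = v.map (·, false) ++ [(a, true)] := Iff.rfl

/-- Two projections characterise the marked words: the letters form a word of `L`, and the marks
read `true false … false`. Both conditions are inverse images of regular languages. The empty word
has no letter to mark and is therefore excluded. -/
theorem IsRegular.markHead {L : Language α} (hL : L.IsRegular) (h0 : [] ∉ L) :
    L.markHead.IsRegular := by
  have h : L.markHead = Language.comap Prod.fst L ⊓
      Language.comap Prod.snd ({[true]} * {[false]}∗ : Language Bool) := by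
    ext w
    rw [mem_markHead, mem_inf, mem_comap, mem_comap]
    simp only [mem_mul, mem_singleton_iff, mem_kstar_letter]
    constructor
    · rintro ⟨_ | ⟨a, v⟩, hv, rfl⟩
      · exact absurd hv h0
      · refine ⟨by simpa [List.markHead, Function.comp_def] using hv, _, rfl, _,
          ⟨v.length, rfl⟩, ?_⟩
        simp [List.markHead, Function.comp_def, List.map_const']
    · rintro ⟨hw, _, rfl, _, ⟨m, rfl⟩, h⟩
      refine ⟨_, hw, ?_⟩
      rcases w with _ | ⟨⟨a, b⟩, v⟩
      · simp at h
      · simp only [List.singleton_append, List.map_cons, List.cons.injEq] at h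
        obtain ⟨rfl, h⟩ := h
        simpa [List.markHead] using List.eq_map_pair_of_snd_eq_replicate h.symm
  rw [h]
  exact (hL.comap _).inf (((isRegular_letter _).mul (isRegular_letter _).kstar).comap _)

theorem IsRegular.markLast {L : Language α} (hL : L.IsRegular) :
    L.markLast.IsRegular := by
  have h : L.markLast = Language.comap Prod.fst L ⊓
      Language.comap Prod.snd ({[false]}∗ * {[true]} : Language Bool) := by
    ext w
    rw [mem_markLast, mem_inf, mem_comap, mem_comap]
    simp only [mem_mul, mem_singleton_iff, mem_kstar_letter]
    constructor
    · rintro ⟨v, a, hv, rfl⟩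
      refine ⟨by simpa [Function.comp_def] using hv, _, ⟨v.length, rfl⟩, _, rfl, ?_⟩
      simp [Function.comp_def, List.map_const']
    · rintro ⟨hw, _, ⟨m, rfl⟩, _, rfl, h⟩
      obtain ⟨v, v', rfl, h1, h2⟩ := List.map_eq_append_iff.1 h.symm
      obtain ⟨⟨a, b⟩, rfl, hb⟩ := List.map_eq_singleton_iff.1 h2
      refine ⟨v.map Prod.fst, a, by simpa using hw, ?_⟩
      rw [← List.eq_map_pair_of_snd_eq_replicate h1]
      simpa using hb
  rw [h]
  exact (hL.comap _).inf (((isRegular_letter _).kstar.mul (isRegular_letter _)).comap _)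

end Language

/-! ### Machines: automata with total registers, whose control is a regular language -/

namespace PMap

variable {α β γ : Type*}

@[simp]
theorem map_apply (f : β → γ) (p : PMap α β) (a : α) : p.map f a = (p a).map f := rfl

theorem map_map {δ : Type*} (g : γ → δ) (f : β → γ) (p : PMap α β) :
    (p.map f).map g = p.map (g ∘ f) := by
  ext1
  funext a
  exact Option.map_map g f (p a)

theorem restrict_map (f : β → γ) (p : PMap α β) (s : Set α) :
    (p.restrict s).map f = (p.map f).restrict s := by
  ext1
  funext a
  by_cases h : a ∈ s <;> simp [map, restrict, h]

end PMap

/-! ### Register functions given by expressions -/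

namespace Setting

variable {A : Type u} {D T X : Type*} {k : ℕ} (𝒮 : Setting A D T X k)

/-- The functions of register values and input values that are given by expressions. -/
inductive Expressible {V : Type*} : ((V → D) → (A → D) → D) → Prop
  | const (d : D) : Expressible fun _ _ => d
  | reg (v : V) : Expressible fun ρ _ => ρ v
  | attr (a : A) : Expressible fun _ x => x a
  | op (i : Fin k) {g h} (hg : Expressible g) (hh : Expressible h) :
      Expressible fun ρ x => (𝒮.monoid i).mul (g ρ x) (h ρ x)

variable {𝒮}

theorem Expressible.comp {V W : Type*} {g : (V → D) → (A → D) → D} (hg : 𝒮.Expressible g)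
    {s : (W → D) → (A → D) → V → D} (hs : ∀ v, 𝒮.Expressible fun ρ x => s ρ x v) :
    𝒮.Expressible fun ρ x => g (s ρ x) x := by
  induction hg with
  | const d => exact .const d
  | reg v => exact hs v
  | attr a => exact .attr a
  | op i _ _ ihg ihh => exact .op i ihg ihh

theorem Expressible.multiset_prod {V ι : Type*} (i : Fin k) (m : Multiset ι)
    {g : ι → (V → D) → (A → D) → D} (hg : ∀ j, 𝒮.Expressible (g j)) :
    𝒮.Expressible fun ρ x => letI := 𝒮.monoid i; (m.map fun j => g j ρ x).prod := by
  let _ := 𝒮.monoid i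
  induction m using Multiset.induction with
  | empty => simpa using Expressible.const (1 : D)
  | cons j m ih =>
    simp only [Multiset.map_cons, Multiset.prod_cons]
    exact Expressible.op i (hg j) ih

end Setting

/-! ### Register conditions that predicates can test -/

section

variable {A : Type u} {D : Type*}

/-- The conditions on register values and the time that are tested by predicates. -/
inductive Testable (Preds : Set (Set (Event A D))) {V : Type*} : Set ((V → D) × ℕ) → Prop
  | univ : Testable Preds Set.univ
  | event {P} (hP : P ∈ Preds) (r : PMap A V) : Testable Preds {x | ⟨r.map x.1, x.2⟩ ∈ P}
  | eq (v w : V) : Testable Preds {x | x.1 v = x.1 w}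
  | inter {p q} (hp : Testable Preds p) (hq : Testable Preds q) : Testable Preds (p ∩ q)
  | compl {p} (hp : Testable Preds p) : Testable Preds pᶜ

namespace Testable

variable {Preds : Set (Set (Event A D))} {V W ι : Type*}

theorem comap {p : Set ((V → D) × ℕ)} (hp : Testable Preds p) (f : V → W) :
    Testable Preds {x : (W → D) × ℕ | (x.1 ∘ f, x.2) ∈ p} := by
  induction hp with
  | univ => exact univ
  | event hP r =>
    have := event (V := W) hP (r.map f)
    simp only [PMap.map_map] at this
    exact this
  | eq v w => exact eq (f v) (f w)
  | inter _ _ ihp ihq => exact inter ihp ihq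
  | compl _ ih => exact compl ih

theorem const (q : Prop) : Testable Preds {_x : (V → D) × ℕ | q} := by
  by_cases h : q
  · simpa [h] using univ
  · simpa [h] using univ.compl

theorem and {p q : (V → D) × ℕ → Prop} (hp : Testable Preds {x | p x})
    (hq : Testable Preds {x | q x}) : Testable Preds {x | p x ∧ q x} :=
  inter hp hq

theorem forall_mem_finset (s : Finset ι) {p : ι → (V → D) × ℕ → Prop}
    (hp : ∀ i ∈ s, Testable Preds {x | p i x}) : Testable Preds {x | ∀ i ∈ s, p i x} := by
  classical
  induction s using Finset.induction_on with
  | empty => simpa using univ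
  | insert i s _ ih =>
    simp only [Finset.mem_insert, forall_eq_or_imp] at hp ⊢
    exact and hp.1 (ih hp.2)

theorem forall_mem_multiset (s : Multiset ι) {p : ι → (V → D) × ℕ → Prop}
    (hp : ∀ i ∈ s, Testable Preds {x | p i x}) : Testable Preds {x | ∀ i ∈ s, p i x} := by
  classical
  simpa using forall_mem_finset s.toFinset (p := p) (by simpa using hp)

theorem exists_mem_multiset (s : Multiset ι) {p : ι → (V → D) × ℕ → Prop}
    (hp : ∀ i ∈ s, Testable Preds {x | p i x}) : Testable Preds {x | ∃ i ∈ s, p i x} := by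
  have := (forall_mem_multiset s (p := fun i x => ¬ p i x) fun i hi => (hp i hi).compl).compl
  have h : {x | ∀ i ∈ s, ¬ p i x}ᶜ = {x | ∃ i ∈ s, p i x} := by
    ext x
    simp
  rwa [h] at this

/-- Equality of bags is a finite Boolean combination: the first element of `s` is matched with some
`j` in `t`, and the rest of `s` agrees with `t.erase j`. This allows a machine to test that two
outputs coincide. -/
theorem map_eq_map {κ E : Type*} (s : Multiset ι) (t : Multiset κ)
    {f : ι → (V → D) × ℕ → E} {g : κ → (V → D) × ℕ → E}
    (h : ∀ i j, Testable Preds {x | f i x = g j x}) :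
    Testable Preds {x | s.map (f · x) = t.map (g · x)} := by
  classical
  induction s using Multiset.induction generalizing t with
  | empty =>
    have := const (Preds := Preds) (V := V) (D := D) (t = 0)
    simpa only [Multiset.map_zero, eq_comm (a := (0 : Multiset E)), Multiset.map_eq_zero]
  | cons i s ih =>
    have := exists_mem_multiset t (p := fun j x => f i x = g j x ∧
      s.map (f · x) = (t.erase j).map (g · x)) fun j _ => and (h i j) (ih (t.erase j))
    have e : {x | (i ::ₘ s).map (f · x) = t.map (g · x)} = {x | ∃ j ∈ t, f i x = g j x ∧
        s.map (f · x) = (t.erase j).map (g · x)} := by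
      ext x
      rw [Set.mem_ofPred_eq, Multiset.map_cons, eq_comm]
      constructor
      · intro hx
        have hm : f i x ∈ t.map (g · x) := hx ▸ Multiset.mem_cons_self _ _
        obtain ⟨j, hj, hjx⟩ := Multiset.mem_map.1 hm
        refine ⟨j, hj, hjx.symm, ?_⟩
        rw [← Multiset.cons_erase hj, Multiset.map_cons, hjx] at hx
        exact ((Multiset.cons_inj_right _).1 hx).symm
      · rintro ⟨j, hj, hjx, hx⟩
        rw [hjx, hx, ← Multiset.map_cons (g · x), Multiset.cons_erase hj]
    rwa [e]

/-- The domains of both events are fixed by `r` and `s`. At each of the finitely many relevant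
attributes the condition is constant or an equality of two registers. -/
theorem map_event_eq (r s : PMap A V) :
    Testable (V := V) Preds {x | (⟨r.map x.1, x.2⟩ : Event A D) = ⟨s.map x.1, x.2⟩} := by
  have h : {x : (V → D) × ℕ | (⟨r.map x.1, x.2⟩ : Event A D) = ⟨s.map x.1, x.2⟩} =
      {x | ∀ a ∈ (r.finite_dom.union s.finite_dom).toFinset,
        (r a).map x.1 = (s a).map x.1} := by
    ext x
    simp only [Event.mk.injEq, and_true, PMap.ext_iff, Set.mem_ofPred_eq, Set.Finite.mem_toFinset,
      Set.mem_union]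
    constructor
    · intro hx a _
      exact congrFun hx a
    · intro hx
      funext a
      by_cases ha : (r a).isSome ∨ (s a).isSome
      · exact hx a ha
      · simp only [not_or, Option.not_isSome_iff_eq_none] at ha
        change (r a).map x.1 = (s a).map x.1
        rw [ha.1, ha.2]
  rw [h]
  refine forall_mem_finset _ fun a _ => ?_
  rcases r a with _ | v <;> rcases s a with _ | w
  · simpa using univ
  · simpa using const False
  · simpa using const False
  · simpa using eq v w

end Testable

end

/-- An instruction of a machine with registers `V`: it updates the registers, tests them and outputs
renamed copies of them. -/
structure Instr {A : Type u} {D T X : Type*} {k : ℕ} (𝒮 : Setting A D T X k)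
    (Preds : Set (Set (Event A D))) (V : Type u) where
  upd : (V → D) → (A → D) → V → D
  pred : Set ((V → D) × ℕ)
  out : X → Multiset (PMap A V)
  expressible : ∀ v, 𝒮.Expressible fun ρ x => upd ρ x v
  testable : Testable Preds pred

namespace Instr

variable {A : Type u} {D T X : Type*} {k : ℕ} {𝒮 : Setting A D T X k}
  {Preds : Set (Set (Event A D))} {V W : Type u}

/-- The events that an instruction outputs at time `i` when the updated registers are `ρ`. -/
def emit (a : Instr 𝒮 Preds V) (ρ : V → D) (i : ℕ) (Z : X) : Multiset (Event A D) :=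
  (a.out Z).map fun r => ⟨r.map ρ, i⟩

/-- The registers after the execution of a word of instructions from position `i` on. -/
def mem (f : ℕ → A → D) : ℕ → (V → D) → List (Instr 𝒮 Preds V) → V → D
  | _, ρ, [] => ρ
  | i, ρ, a :: w => mem f (i + 1) (a.upd ρ (f i)) w

/-- All tests of a word of instructions succeed. -/
def Ok (f : ℕ → A → D) : ℕ → (V → D) → List (Instr 𝒮 Preds V) → Prop
  | _, _, [] => True
  | i, ρ, a :: w => (a.upd ρ (f i), i) ∈ a.pred ∧ Ok f (i + 1) (a.upd ρ (f i)) w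

/-- The output of a word of instructions. -/
def output (f : ℕ → A → D) : ℕ → (V → D) → List (Instr 𝒮 Preds V) → X → Multiset (Event A D)
  | _, _, [] => 0
  | i, ρ, a :: w => a.emit (a.upd ρ (f i)) i + output f (i + 1) (a.upd ρ (f i)) w

variable {f : ℕ → A → D}

/-! ### Execution of concatenated words, and simulation on part of the registers -/

theorem mem_append (i : ℕ) (ρ : V → D) (w w' : List (Instr 𝒮 Preds V)) :
    mem f i ρ (w ++ w') = mem f (i + w.length) (mem f i ρ w) w' := by
  induction w generalizing i ρ with
  | nil => rfl
  | cons a w ih =>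
    simp only [List.cons_append, mem, ih, List.length_cons]
    congr 1
    omega

theorem ok_append (i : ℕ) (ρ : V → D) (w w' : List (Instr 𝒮 Preds V)) :
    Ok f i ρ (w ++ w') ↔ Ok f i ρ w ∧ Ok f (i + w.length) (mem f i ρ w) w' := by
  induction w generalizing i ρ with
  | nil => simp [Ok, mem]
  | cons a w ih =>
    simp only [List.cons_append, Ok, mem, ih, List.length_cons, and_assoc]
    rw [show i + (w.length + 1) = i + 1 + w.length by omega]

theorem output_append (i : ℕ) (ρ : V → D) (w w' : List (Instr 𝒮 Preds V)) :
    output f i ρ (w ++ w') = output f i ρ w + output f (i + w.length) (mem f i ρ w) w' := by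
  induction w generalizing i ρ with
  | nil => simp [output, mem]
  | cons a w ih =>
    simp only [List.cons_append, output, mem, ih, List.length_cons, add_assoc]
    rw [show i + (w.length + 1) = i + (1 + w.length) by omega]

theorem le_time_of_mem_output {i : ℕ} {ρ : V → D} {w : List (Instr 𝒮 Preds V)} {Z : X}
    {e : Event A D} (he : e ∈ output f i ρ w Z) : i ≤ e.time := by
  induction w generalizing i ρ with
  | nil => simp [output] at he
  | cons a w ih =>
    rw [output, Pi.add_apply, Multiset.mem_add] at he
    rcases he with he | he
    · obtain ⟨r, -, rfl⟩ := Multiset.mem_map.1 he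
      exact le_rfl
    · exact (Nat.le_succ i).trans (ih he)

/-- On the registers selected by `ι`, the instruction `a'` computes what `a` computes. -/
def UpdSim (ι : V → W) (a' : Instr 𝒮 Preds W) (a : Instr 𝒮 Preds V) : Prop :=
  ∀ ρ x, a'.upd ρ x ∘ ι = a.upd (ρ ∘ ι) x

/-- On the registers selected by `ι`, the instruction `a'` tests what `a` tests. -/
def PredSim (ι : V → W) (a' : Instr 𝒮 Preds W) (a : Instr 𝒮 Preds V) : Prop :=
  ∀ ρ i, (ρ, i) ∈ a'.pred ↔ (ρ ∘ ι, i) ∈ a.pred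

/-- From the registers selected by `ι`, the instruction `a'` outputs what `a` outputs. -/
def OutSim (ι : V → W) (a' : Instr 𝒮 Preds W) (a : Instr 𝒮 Preds V) : Prop :=
  ∀ Z, a'.out Z = (a.out Z).map (PMap.map ι)

variable {Δ : Type*} {ι : V → W} {p' : Δ → Instr 𝒮 Preds W} {p : Δ → Instr 𝒮 Preds V}

theorem OutSim.emit_eq {a' : Instr 𝒮 Preds W} {a : Instr 𝒮 Preds V} (h : OutSim ι a' a)
    (ρ : W → D) (i : ℕ) : a'.emit ρ i = a.emit (ρ ∘ ι) i := by
  funext Z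
  simp [emit, h Z, PMap.map_map, Multiset.map_map, Function.comp_def]

/-- The registers in the range of `ι` are not influenced by the others, so an execution of the
smaller machine is obtained by restriction. This and the next two lemmas serve the constructions
that add registers. -/
theorem mem_sim (hu : ∀ a, UpdSim ι (p' a) (p a)) (i : ℕ) (ρ : W → D) (w : List Δ) :
    mem f i ρ (w.map p') ∘ ι = mem f i (ρ ∘ ι) (w.map p) := by
  induction w generalizing i ρ with
  | nil => rfl
  | cons a w ih => simp only [List.map_cons, mem, ih, hu a ρ]

theorem ok_sim (hu : ∀ a, UpdSim ι (p' a) (p a)) (hp : ∀ a, PredSim ι (p' a) (p a)) (i : ℕ)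
    (ρ : W → D) (w : List Δ) : Ok f i ρ (w.map p') ↔ Ok f i (ρ ∘ ι) (w.map p) := by
  induction w generalizing i ρ with
  | nil => rfl
  | cons a w ih => simp only [List.map_cons, Ok, ih, hp a _ i, hu a ρ]

theorem output_sim (hu : ∀ a, UpdSim ι (p' a) (p a)) (ho : ∀ a, OutSim ι (p' a) (p a)) (i : ℕ)
    (ρ : W → D) (w : List Δ) : output f i ρ (w.map p') = output f i (ρ ∘ ι) (w.map p) := by
  induction w generalizing i ρ with
  | nil => rfl
  | cons a w ih => simp only [List.map_cons, output, ih, (ho a).emit_eq, hu a ρ]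

theorem mem_of_forall_upd (w : List (Instr 𝒮 Preds W))
    (hu : ∀ a ∈ w, ∀ ρ x, a.upd ρ x ∘ ι = ρ ∘ ι) (i : ℕ) (ρ : W → D) :
    mem f i ρ w ∘ ι = ρ ∘ ι := by
  induction w generalizing i ρ with
  | nil => rfl
  | cons a w ih =>
    rw [List.forall_mem_cons] at hu
    rw [mem, ih hu.2, hu.1]

/-- The instruction that does nothing. -/
def skip : Instr 𝒮 Preds V where
  upd ρ _ := ρ
  pred := Set.univ
  out _ := 0
  expressible v := .reg v
  testable := .univ

theorem ok_replicate_skip (i : ℕ) (ρ : V → D) (m : ℕ) :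
    Ok f i ρ (List.replicate m (skip : Instr 𝒮 Preds V)) := by
  induction m generalizing i with
  | zero => trivial
  | succ m ih => exact ⟨trivial, ih (i + 1)⟩

theorem mem_replicate_skip (i : ℕ) (ρ : V → D) (m : ℕ) :
    mem f i ρ (List.replicate m (skip : Instr 𝒮 Preds V)) = ρ := by
  induction m generalizing i with
  | zero => rfl
  | succ m ih => exact ih (i + 1)

theorem output_replicate_skip (i : ℕ) (ρ : V → D) (m : ℕ) :
    output f i ρ (List.replicate m (skip : Instr 𝒮 Preds V)) = 0 := by
  induction m generalizing i with
  | zero => rfl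
  | succ m ih =>
    have := ih (i + 1)
    simp only [List.replicate_succ, output, skip] at this ⊢
    rw [this]
    rfl

end Instr

/-- A machine: a regular set of words of instructions, over finitely many registers with initial
values. -/
structure Machine {A : Type u} {D T X : Type*} {k : ℕ} (𝒮 : Setting A D T X k)
    (Preds : Set (Set (Event A D))) where
  Reg : Type u
  finite_reg : Finite Reg
  Letter : Type
  finite_letter : Finite Letter
  instr : Letter → Instr 𝒮 Preds Reg
  init : Reg → D
  lang : Language Letter
  regular : lang.IsRegular
  nil_notMem : [] ∉ lang

attribute [instance] Machine.finite_reg Machine.finite_letter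

section

variable {A : Type u} {D T X : Type*} {k : ℕ} (𝒮 : Setting A D T X k)
  {Preds : Set (Set (Event A D))}

/-- The attribute values at position `i` of a stream. -/
def Setting.inputs (S : List (Event A D)) (i : ℕ) : A → D :=
  (S[i - 1]?).elim (fun _ => 𝒮.null) 𝒮.val

variable {𝒮}

namespace Machine

variable (M : Machine 𝒮 Preds) (S : List (Event A D))

/-- The tests of the word `w` succeed from position `i` on. -/
def Ok (i : ℕ) (w : List M.Letter) : Prop :=
  Instr.Ok (𝒮.inputs S) i M.init (w.map M.instr)

/-- The output of the word `w` from position `i` on. -/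
def output (i : ℕ) (w : List M.Letter) : X → Multiset (Event A D) :=
  Instr.output (𝒮.inputs S) i M.init (w.map M.instr)

/-- The complex events over a stream that a machine defines. -/
def sem : Set (ComplexEvent A D X) :=
  {C | 1 ≤ C.start ∧ C.finish ≤ S.length ∧ ∃ w ∈ M.lang, C.finish + 1 = C.start + w.length ∧
    M.Ok S C.start w ∧ C.bag = M.output S C.start w}

theorem length_pos {w : List M.Letter} (hw : w ∈ M.lang) : 0 < w.length :=
  List.length_pos_iff.2 fun h => M.nil_notMem (h ▸ hw)

end Machine

variable (𝒮 Preds) in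
/-- A function from streams to sets of complex events is definable if some machine defines it over
all streams. -/
def Definable (Sch : T → Finset A) (F : List (Event A D) → Set (ComplexEvent A D X)) : Prop :=
  ∃ M : Machine 𝒮 Preds, ∀ S, 𝒮.IsStream Sch S → M.sem S = F S

end

/-! ### Closure properties of definable functions -/

section

variable {A : Type u} {D T X : Type*} {k : ℕ} {𝒮 : Setting A D T X k}
  {Preds : Set (Set (Event A D))}

namespace ComplexEvent

/-- The complex event that starts at `i` and spans `n` positions. -/
def span (i n : ℕ) (μ : X → Multiset (Event A D)) : ComplexEvent A D X :=
  ⟨i, i + n - 1, μ⟩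

theorem union_span {i a m b : ℕ} (ha : 0 < a) (hb : 0 < b) (μ ν : X → Multiset (Event A D)) :
    (span i a μ).union (span (i + a + m) b ν) = span i (a + m + b) (μ + ν) := by
  simp only [union, span, mk.injEq]
  exact ⟨by omega, by omega, rfl⟩

theorem eq_span {C : ComplexEvent A D X} {i n : ℕ} {μ : X → Multiset (Event A D)}
    (h₁ : C.start = i) (h₂ : C.finish + 1 = i + n) (h₃ : C.bag = μ) : C = span i n μ := by
  ext1
  · exact h₁
  · simp only [span]
    omega
  · exact h₃

/-- Positive lengths are needed because of truncated subtraction: at position 0, spans of lengths 0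
and 1 have the same end. -/
theorem span_inj {i a j b : ℕ} {μ ν : X → Multiset (Event A D)} (ha : 0 < a) (hb : 0 < b)
    (h : span i a μ = span j b ν) : i = j ∧ a = b ∧ μ = ν := by
  simp only [span, mk.injEq] at h
  obtain ⟨h1, h2, h3⟩ := h
  exact ⟨h1, by omega, h3⟩

end ComplexEvent

open ComplexEvent

theorem Machine.mem_sem_iff {M : Machine 𝒮 Preds} {S : List (Event A D)}
    {C : ComplexEvent A D X} :
    C ∈ M.sem S ↔ ∃ i, 1 ≤ i ∧ ∃ w ∈ M.lang, i + w.length ≤ S.length + 1 ∧ M.Ok S i w ∧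
      C = span i w.length (M.output S i w) := by
  constructor
  · rintro ⟨h1, h2, w, hw, h3, h4, h5⟩
    exact ⟨_, h1, w, hw, by omega, h4, eq_span rfl h3 h5⟩
  · rintro ⟨i, hi, w, hw, h, hok, rfl⟩
    have := M.length_pos hw
    refine ⟨hi, ?_, w, hw, ?_, hok, rfl⟩ <;> simp only [span] <;> omega

theorem Definable.congr {Sch : T → Finset A} {F G : List (Event A D) → Set (ComplexEvent A D X)}
    (hF : Definable 𝒮 Preds Sch F) (h : ∀ S, F S = G S) : Definable 𝒮 Preds Sch G :=
  (funext h : F = G) ▸ hF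

/-! #### Event types -/

theorem EventAt.inputs_eq {S : List (Event A D)} {i : ℕ} {e : Event A D} (h : EventAt S i e) :
    𝒮.inputs S i = 𝒮.val e := by
  simp [Setting.inputs, h.2]

theorem EventAt.le_length {S : List (Event A D)} {i : ℕ} {e : Event A D} (h : EventAt S i e) :
    i ≤ S.length := by
  obtain ⟨h1, h2⟩ := h
  obtain ⟨h3, -⟩ := List.getElem?_eq_some_iff.1 h2
  omega

theorem exists_eventAt {S : List (Event A D)} {i : ℕ} (h1 : 1 ≤ i) (h2 : i ≤ S.length) :
    ∃ e, EventAt S i e :=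
  ⟨S[i - 1]'(by omega), h1, List.getElem?_eq_getElem _⟩

open Classical in
/-- The identity on a finite set, as a mapping to the subtype. -/
noncomputable def PMap.idOn {α : Type*} (s : Set α) (hs : s.Finite) : PMap α s :=
  ⟨fun a => if h : a ∈ s then some ⟨a, h⟩ else none, hs.subset fun a ha => by
    by_contra h
    simp [h] at ha⟩

theorem PMap.idOn_of_mem {α : Type*} {s : Set α} (hs : s.Finite) {a : α} (h : a ∈ s) :
    PMap.idOn s hs a = some ⟨a, h⟩ :=
  dif_pos h

theorem PMap.idOn_of_notMem {α : Type*} {s : Set α} (hs : s.Finite) {a : α} (h : a ∉ s) :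
    PMap.idOn s hs a = none :=
  dif_neg h

/-- The attributes of the events of type `R`. -/
def Setting.typeAtts (𝒮 : Setting A D T X k) (Sch : T → Finset A) (R : T) : Set A :=
  ↑(Sch R) ∪ {𝒮.typeAttr}

theorem Setting.finite_typeAtts (𝒮 : Setting A D T X k) (Sch : T → Finset A) (R : T) :
    (𝒮.typeAtts Sch R).Finite :=
  (Sch R).finite_toSet.union (Set.finite_singleton _)

theorem Setting.typeAttr_mem_typeAtts (𝒮 : Setting A D T X k) (Sch : T → Finset A) (R : T) :
    𝒮.typeAttr ∈ 𝒮.typeAtts Sch R :=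
  Or.inr rfl

theorem Setting.data_eq_some_val {e : Event A D} {a : A} (h : a ∈ e.att) :
    e.data a = some (𝒮.val e a) := by
  obtain ⟨d, hd⟩ := Option.isSome_iff_exists.1 (show (e.data a).isSome from h)
  rw [Setting.val, hd, Option.getD_some]

theorem Setting.Satisfies.att_eq {Sch : T → Finset A} {e : Event A D}
    (h : 𝒮.Satisfies Sch e) {R : T} (hR : 𝒮.val e 𝒮.typeAttr = 𝒮.tyVal R) :
    e.att = 𝒮.typeAtts Sch R := by
  obtain ⟨R', h1, h2⟩ := h
  rw [Setting.val, h1, Option.getD_some] at hR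
  rwa [𝒮.tyVal.injective hR] at h2

open Classical in
/-- The machine for the selection of an event type. -/
noncomputable def Machine.ty (hPreds : 𝒮.IsPredicateFamily Preds) (Sch : T → Finset A) (R : T) :
    Machine 𝒮 Preds where
  Reg := 𝒮.typeAtts Sch R
  finite_reg := 𝒮.finite_typeAtts Sch R
  Letter := Unit
  finite_letter := inferInstance
  instr _ :=
    { upd := fun _ x v => x v
      pred := {x | x.1 ⟨𝒮.typeAttr, 𝒮.typeAttr_mem_typeAtts Sch R⟩ = 𝒮.tyVal R}
      out := fun Z => if Z = 𝒮.tyVar R then {PMap.idOn _ (𝒮.finite_typeAtts Sch R)} else 0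
      expressible := fun v => .attr v.1
      testable := by
        have := Testable.event (hPreds.type_mem R) (PMap.idOn _ (𝒮.finite_typeAtts Sch R))
        simpa [Setting.val, PMap.idOn_of_mem _ (𝒮.typeAttr_mem_typeAtts Sch R)] using this }
  init _ := 𝒮.null
  lang := {[()]}
  regular := Language.isRegular_letter _
  nil_notMem h := by simp [Language.mem_singleton_iff] at h

theorem definable_ty (hPreds : 𝒮.IsPredicateFamily Preds) (Sch : T → Finset A) (R : T) :
    Definable 𝒮 Preds Sch fun S => {C | ∃ e, EventAt S C.start e ∧ C.finish = C.start ∧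
      𝒮.val e 𝒮.typeAttr = 𝒮.tyVal R ∧
      C.bag (𝒮.tyVar R) = {e} ∧ ∀ Z, Z ≠ 𝒮.tyVar R → C.bag Z = 0} := by
  classical
  refine ⟨Machine.ty hPreds Sch R, fun S hS => ?_⟩
  -- The registers are exactly the attributes of `R`, and by the schema so is the domain of `e`.
  -- Hence the emitted copy is `e` itself and not just an event with the same values.
  have key : ∀ i e, EventAt S i e → 𝒮.val e 𝒮.typeAttr = 𝒮.tyVal R →
      (⟨(PMap.idOn _ (𝒮.finite_typeAtts Sch R)).map
        fun v : 𝒮.typeAtts Sch R => 𝒮.val e v, i⟩ : Event A D) = e := by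
    intro i e he hR
    obtain ⟨hsat, ht⟩ := hS i e he
    have hatt := hsat.att_eq hR
    ext1
    · ext1
      funext a
      change ((PMap.idOn _ (𝒮.finite_typeAtts Sch R)) a).map _ = e.data a
      by_cases ha : a ∈ 𝒮.typeAtts Sch R
      · rw [PMap.idOn_of_mem _ ha, Setting.data_eq_some_val (𝒮 := 𝒮) (hatt ▸ ha)]
        rfl
      · rw [PMap.idOn_of_notMem _ ha]
        rw [← hatt] at ha
        exact (Option.not_isSome_iff_eq_none.1 ha).symm
    · exact ht.symm
  ext C
  constructor
  · rintro ⟨h1, h2, w, rfl, h3, h4, h5⟩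
    have h3' : C.finish = C.start := Nat.succ.inj h3
    obtain ⟨e, he⟩ := exists_eventAt h1 (h3' ▸ h2)
    have hR : 𝒮.val e 𝒮.typeAttr = 𝒮.tyVal R := he.inputs_eq (𝒮 := 𝒮) ▸ h4.1
    refine ⟨e, he, h3', hR, ?_⟩
    have hb : ∀ Z, C.bag Z = if Z = 𝒮.tyVar R then ({e} : Multiset (Event A D)) else 0 := by
      intro Z
      rw [h5]
      simp only [Machine.output, Machine.ty, List.map_cons, List.map_nil, Instr.output, Instr.emit,
        he.inputs_eq, add_zero]
      split_ifs
      · rw [Multiset.map_singleton, key _ _ he hR]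
      · rfl
    exact ⟨by simp [hb], fun Z hZ => by simp [hb, hZ]⟩
  · rintro ⟨e, he, h3, hR, hb1, hb2⟩
    refine ⟨he.1, h3 ▸ he.le_length, [()], rfl, congrArg Nat.succ h3, ⟨?_, trivial⟩, ?_⟩
    · exact he.inputs_eq (𝒮 := 𝒮) ▸ hR
    · funext Z
      simp only [Machine.output, Machine.ty, List.map_cons, List.map_nil, Instr.output, Instr.emit,
        he.inputs_eq, add_zero]
      split_ifs with h
      · rw [Multiset.map_singleton, key _ _ he hR, h, hb1]
      · exact hb2 Z h

/-! #### Transformations of the output -/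

/-- The bags of a run are sums over positions, so an additive `G` can be applied at each position.
The function `g` is its counterpart on the symbolic output of an instruction, uniformly in the
registers. -/
theorem Definable.mapOut {Sch : T → Finset A} {F : List (Event A D) → Set (ComplexEvent A D X)}
    (hF : Definable 𝒮 Preds Sch F)
    (g : ∀ {V : Type u}, (X → Multiset (PMap A V)) → X → Multiset (PMap A V))
    (G : (X → Multiset (Event A D)) →+ (X → Multiset (Event A D)))
    (hG : ∀ {V : Type u} (o : X → Multiset (PMap A V)) (ρ : V → D) (i : ℕ),
      (fun Z => (g o Z).map fun r => (⟨r.map ρ, i⟩ : Event A D)) =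
        G fun Z => (o Z).map fun r => ⟨r.map ρ, i⟩) :
    Definable 𝒮 Preds Sch fun S =>
      {C | ∃ C' ∈ F S, C.start = C'.start ∧ C.finish = C'.finish ∧ C.bag = G C'.bag} := by
  obtain ⟨M, hM⟩ := hF
  let p : M.Letter → Instr 𝒮 Preds M.Reg := fun a => { M.instr a with out := g (M.instr a).out }
  have hu : ∀ a, Instr.UpdSim id (p a) (M.instr a) := fun _ _ _ => rfl
  have hok : ∀ S i w, Instr.Ok (𝒮.inputs S) i M.init (w.map p) ↔ M.Ok S i w :=
    fun S i w => Instr.ok_sim hu (fun _ _ _ => Iff.rfl) i M.init w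
  have hout : ∀ S i ρ (w : List M.Letter), Instr.output (𝒮.inputs S) i ρ (w.map p) =
      G (Instr.output (𝒮.inputs S) i ρ (w.map M.instr)) := by
    intro S i ρ w
    induction w generalizing i ρ with
    | nil => exact (map_zero G).symm
    | cons a w ih =>
      simp only [List.map_cons, Instr.output, ih, map_add]
      congr 1
      exact hG _ _ _
  refine ⟨{ M with instr := p }, fun S hS => ?_⟩
  beta_reduce
  rw [← hM S hS]
  ext C
  constructor
  · rintro ⟨h1, h2, w, hw, h3, h4, h5⟩
    exact ⟨⟨_, _, M.output S C.start w⟩, ⟨h1, h2, w, hw, h3, (hok ..).1 h4, rfl⟩, rfl, rfl,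
      h5.trans (hout ..)⟩
  · rintro ⟨⟨i, j, μ⟩, ⟨h1, h2, w, hw, h3, h4, h5⟩, rfl, rfl, h6⟩
    refine ⟨h1, h2, w, hw, h3, (hok ..).2 h4, ?_⟩
    rw [h6, h5]
    exact (hout ..).symm

open Classical in
theorem Definable.as [Fintype X] {Sch : T → Finset A}
    {F : List (Event A D) → Set (ComplexEvent A D X)} (hF : Definable 𝒮 Preds Sch F) (Y : X) :
    Definable 𝒮 Preds Sch fun S => {C | ∃ C' ∈ F S, C.start = C'.start ∧ C.finish = C'.finish ∧
      C.bag Y = ∑ Z, C'.bag Z ∧ ∀ Z, Z ≠ Y → C.bag Z = C'.bag Z} := by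
  refine (hF.mapOut (fun o => Function.update o Y (∑ Z, o Z))
    { toFun := fun μ => Function.update μ Y (∑ Z, μ Z)
      map_zero' := by simp
      map_add' := fun μ ν => by
        funext Z
        by_cases h : Z = Y
        · subst h; simp [Finset.sum_add_distrib]
        · simp [h] } ?_).congr fun S => ?_
  · intro V o ρ i
    funext Z
    by_cases h : Z = Y
    · subst h
      simp only [Function.update_self, AddMonoidHom.coe_mk, ZeroHom.coe_mk]
      exact map_sum (Multiset.mapAddMonoidHom fun r : PMap A V => (⟨r.map ρ, i⟩ : Event A D))
        o Finset.univ
    · simp [h]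
  · simp only [AddMonoidHom.coe_mk, ZeroHom.coe_mk, Function.eq_update_iff]

open Classical in
theorem Definable.proj {Sch : T → Finset A}
    {F : List (Event A D) → Set (ComplexEvent A D X)} (hF : Definable 𝒮 Preds Sch F) (L : Set X) :
    Definable 𝒮 Preds Sch fun S => {C | ∃ C' ∈ F S, C.start = C'.start ∧ C.finish = C'.finish ∧
      (∀ Z, Z ∈ L → C.bag Z = C'.bag Z) ∧ ∀ Z, Z ∉ L → C.bag Z = 0} := by
  refine (hF.mapOut (fun o => L.piecewise o 0)
    { toFun := fun μ => L.piecewise μ 0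
      map_zero' := by simp
      map_add' := fun μ ν => by
        funext Z
        by_cases h : Z ∈ L <;> simp [h] } ?_).congr fun S => ?_
  · intro V o ρ i
    funext Z
    by_cases h : Z ∈ L <;> simp [h]
  · have h : ∀ μ ν : X → Multiset (Event A D), μ = L.piecewise ν 0 ↔
        (∀ Z, Z ∈ L → μ Z = ν Z) ∧ ∀ Z, Z ∉ L → μ Z = 0 := by
      intro μ ν
      refine ⟨?_, fun h => ?_⟩
      · rintro rfl
        exact ⟨fun Z hZ => by simp [hZ], fun Z hZ => by simp [hZ]⟩
      · funext Z
        by_cases hZ : Z ∈ L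
        · simp [hZ, h.1]
        · simp [hZ, h.2]
    simp only [AddMonoidHom.coe_mk, ZeroHom.coe_mk, h]

open Classical in
theorem Definable.attProj {Sch : T → Finset A}
    {F : List (Event A D) → Set (ComplexEvent A D X)} (hF : Definable 𝒮 Preds Sch F) (Y : X)
    (s : Finset A) :
    Definable 𝒮 Preds Sch fun S => {C | ∃ C' ∈ F S, C.start = C'.start ∧ C.finish = C'.finish ∧
      C.bag Y = (C'.bag Y).map (fun e => e.proj s) ∧ ∀ Z, Z ≠ Y → C.bag Z = C'.bag Z} := by
  refine (hF.mapOut (fun o => Function.update o Y ((o Y).map fun r => r.restrict s))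
    { toFun := fun μ => Function.update μ Y ((μ Y).map fun e => e.proj s)
      map_zero' := by simp
      map_add' := fun μ ν => by
        funext Z
        by_cases h : Z = Y
        · subst h; simp
        · simp [h] } ?_).congr fun S => ?_
  · intro V o ρ i
    funext Z
    by_cases h : Z = Y
    · subst h
      simp [Multiset.map_map, Event.proj, PMap.restrict_map]
    · simp [h]
  · simp only [AddMonoidHom.coe_mk, ZeroHom.coe_mk, Function.eq_update_iff]

/-! #### Filters -/

/-- A condition on all events of a bag splits into conditions on the events emitted at each
position. These are finitely many renamed copies of the registers, so the tests of the instructions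
can include them. -/
theorem Definable.filter {Sch : T → Finset A} {F : List (Event A D) → Set (ComplexEvent A D X)}
    (hF : Definable 𝒮 Preds Sch F) (Y : X) {P : Set (Event A D)} (hP : P ∈ Preds) :
    Definable 𝒮 Preds Sch fun S => {C | C ∈ F S ∧ ∀ e ∈ C.bag Y, e ∈ P} := by
  obtain ⟨M, hM⟩ := hF
  let p : M.Letter → Instr 𝒮 Preds M.Reg := fun a =>
    { M.instr a with
      pred := (M.instr a).pred ∩ {x | ∀ r ∈ (M.instr a).out Y, (⟨r.map x.1, x.2⟩ : Event A D) ∈ P}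
      testable := (M.instr a).testable.inter
        (Testable.forall_mem_multiset _ fun r _ => .event hP r) }
  have hout : ∀ S i ρ (w : List M.Letter), Instr.output (𝒮.inputs S) i ρ (w.map p) =
      Instr.output (𝒮.inputs S) i ρ (w.map M.instr) := by
    intro S i ρ w
    induction w generalizing i ρ with
    | nil => rfl
    | cons a w ih =>
      simp only [List.map_cons, Instr.output, ih]
      rfl
  have hok : ∀ S i ρ (w : List M.Letter), Instr.Ok (𝒮.inputs S) i ρ (w.map p) ↔
      Instr.Ok (𝒮.inputs S) i ρ (w.map M.instr) ∧
      ∀ e ∈ Instr.output (𝒮.inputs S) i ρ (w.map M.instr) Y, e ∈ P := by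
    intro S i ρ w
    induction w generalizing i ρ with
    | nil => simp [Instr.Ok, Instr.output]
    | cons a w ih =>
      have hp : ∀ x, x ∈ (p a).pred ↔ x ∈ (M.instr a).pred ∧
        ∀ e ∈ (M.instr a).emit x.1 x.2 Y, e ∈ P := by
        intro x
        simp [p, Instr.emit]
      simp only [List.map_cons, Instr.Ok, Instr.output, ih, hp, Pi.add_apply, Multiset.mem_add,
        or_imp, forall_and]
      exact and_and_and_comm
  refine ⟨{ M with instr := p }, fun S hS => ?_⟩
  beta_reduce
  rw [← hM S hS]
  ext C
  constructor
  · rintro ⟨h1, h2, w, hw, h3, h4, h5⟩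
    have h5' := h5.trans (hout ..)
    exact ⟨⟨h1, h2, w, hw, h3, ((hok ..).1 h4).1, h5'⟩, h5' ▸ ((hok ..).1 h4).2⟩
  · rintro ⟨⟨h1, h2, w, hw, h3, h4, h5⟩, h6⟩
    refine ⟨h1, h2, w, hw, h3, (hok ..).2 ⟨h4, ?_⟩, h5.trans (hout ..).symm⟩
    rw [h5] at h6
    exact h6

end

section

variable {A : Type u} {D T X : Type*} {k : ℕ} {𝒮 : Setting A D T X k}
  {Preds : Set (Set (Event A D))}

open ComplexEvent

theorem Definable.intro {Sch : T → Finset A} {F : List (Event A D) → Set (ComplexEvent A D X)}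
    {V : Type u} [Finite V] {Δ : Type} [Finite Δ] (p : Δ → Instr 𝒮 Preds V) (init : V → D)
    (L : Language Δ) (hL : L.IsRegular) (h0 : [] ∉ L)
    (h : ∀ S, 𝒮.IsStream Sch S → ∀ C, C ∈ F S ↔
      ∃ i, 1 ≤ i ∧ ∃ w ∈ L, i + w.length ≤ S.length + 1 ∧
        Instr.Ok (𝒮.inputs S) i init (w.map p) ∧
        C = span i w.length (Instr.output (𝒮.inputs S) i init (w.map p))) :
    Definable 𝒮 Preds Sch F :=
  ⟨⟨V, inferInstance, Δ, inferInstance, p, init, L, hL, h0⟩, fun S hS =>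
    Set.ext fun C => Machine.mem_sem_iff.trans (h S hS C).symm⟩

/-! #### Disjunction and sequencing -/

/-- The words `a … a` whose length lies in `G`. -/
def Language.gap {α : Type*} (a : α) (G : Set ℕ) : Language α := {w | ∃ m ∈ G, w = .replicate m a}

theorem Language.mem_gap {α : Type*} {a : α} {G : Set ℕ} {w : List α} :
    w ∈ Language.gap a G ↔ ∃ m ∈ G, w = .replicate m a := Iff.rfl

/-- Sets of numbers for which the words `a … a` of such lengths form a regular language. -/
def IsGap (G : Set ℕ) : Prop := ∀ {α : Type} (a : α), (Language.gap a G).IsRegular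

theorem isGap_zero : IsGap {0} := by
  intro α a
  have h : Language.gap a {0} = 1 := by
    ext w
    simp [Language.mem_gap, Language.mem_one]
  exact h ▸ Language.isRegular_one

theorem isGap_univ : IsGap Set.univ := by
  intro α a
  have h : Language.gap a Set.univ = {[a]}∗ := by
    ext w
    simp [Language.mem_gap, Language.mem_kstar_letter]
  exact h ▸ (Language.isRegular_letter a).kstar

/-- Two complex events follow each other with a gap whose length lies in `G`. -/
def ComplexEvent.Link (G : Set ℕ) (C₁ C₂ : ComplexEvent A D X) : Prop :=
  ∃ m ∈ G, C₁.finish + 1 + m = C₂.start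

theorem ComplexEvent.link_zero :
    (Link {0} : ComplexEvent A D X → ComplexEvent A D X → Prop) =
      fun C₁ C₂ => C₁.finish + 1 = C₂.start := by
  funext C₁ C₂
  simp [Link]

theorem ComplexEvent.link_univ :
    (Link Set.univ : ComplexEvent A D X → ComplexEvent A D X → Prop) =
      fun C₁ C₂ => C₁.finish < C₂.start := by
  funext C₁ C₂
  refine propext ⟨?_, fun h => ⟨C₂.start - (C₁.finish + 1), trivial, by omega⟩⟩
  rintro ⟨m, -, h⟩
  omega

theorem ComplexEvent.link_span {G : Set ℕ} {i a j b : ℕ} {μ ν : X → Multiset (Event A D)}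
    (ha : 0 < a) : Link G (span i a μ) (span j b ν) ↔ ∃ m ∈ G, j = i + a + m := by
  simp only [Link, span]
  refine exists_congr fun m => and_congr_right fun _ => ?_
  omega

namespace Instr

variable {V W : Type u}

/-- The instruction that acts like `a` on the registers selected by `ι`, and leaves the other
registers unchanged. -/
noncomputable def lift (ι : V ↪ W) (a : Instr 𝒮 Preds V) : Instr 𝒮 Preds W where
  upd ρ x := Function.extend ι (a.upd (ρ ∘ ι) x) ρ
  pred := {x | (x.1 ∘ ι, x.2) ∈ a.pred}
  out Z := (a.out Z).map (PMap.map ι)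
  expressible w := by
    by_cases h : ∃ v, ι v = w
    · obtain ⟨v, rfl⟩ := h
      simpa only [ι.injective.extend_apply] using
        (a.expressible v).comp (s := fun ρ _ => ρ ∘ ι) fun v => .reg (ι v)
    · simpa only [Function.extend_apply' _ _ _ h] using .reg w
  testable := a.testable.comap ι

theorem lift_updSim (ι : V ↪ W) (a : Instr 𝒮 Preds V) : UpdSim ι (lift ι a) a :=
  fun _ _ => Function.extend_comp ι.injective _ _

theorem lift_predSim (ι : V ↪ W) (a : Instr 𝒮 Preds V) : PredSim ι (lift ι a) a :=
  fun _ _ => Iff.rfl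

theorem lift_outSim (ι : V ↪ W) (a : Instr 𝒮 Preds V) : OutSim ι (lift ι a) a :=
  fun _ => rfl

theorem lift_upd_comp {V' : Type*} (ι : V ↪ W) (κ : V' → W) (h : ∀ v v', ι v ≠ κ v')
    (a : Instr 𝒮 Preds V) (ρ : W → D) (x : A → D) : (lift ι a).upd ρ x ∘ κ = ρ ∘ κ := by
  funext v'
  exact Function.extend_apply' _ _ _ fun ⟨v, hv⟩ => h v v' hv

end Instr

namespace Machine

variable (M₁ M₂ : Machine 𝒮 Preds)

/-- The instructions of two machines on disjoint registers, and the instruction `skip`. -/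
noncomputable def joinInstr :
    Option (M₁.Letter ⊕ M₂.Letter) → Instr 𝒮 Preds (M₁.Reg ⊕ M₂.Reg)
  | none => .skip
  | some (.inl a) => (M₁.instr a).lift .inl
  | some (.inr a) => (M₂.instr a).lift .inr

/-- The words of the first machine as words of instructions of a joint machine. -/
def leftWord (w : List M₁.Letter) : List (Option (M₁.Letter ⊕ M₂.Letter)) :=
  w.map (some ∘ Sum.inl)

/-- The words of the second machine as words of instructions of a joint machine. -/
def rightWord (w : List M₂.Letter) : List (Option (M₁.Letter ⊕ M₂.Letter)) :=
  w.map (some ∘ Sum.inr)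

theorem length_leftWord (w : List M₁.Letter) : (leftWord M₁ M₂ w).length = w.length :=
  List.length_map _

theorem length_rightWord (w : List M₂.Letter) : (rightWord M₁ M₂ w).length = w.length :=
  List.length_map _

variable {M₁ M₂} {f : ℕ → A → D} (i : ℕ) (ρ : M₁.Reg ⊕ M₂.Reg → D)

theorem ok_leftWord (w : List M₁.Letter) :
    Instr.Ok f i ρ ((leftWord M₁ M₂ w).map (joinInstr M₁ M₂)) ↔
      Instr.Ok f i (ρ ∘ Sum.inl) (w.map M₁.instr) := by
  rw [leftWord, List.map_map]
  exact Instr.ok_sim (ι := Sum.inl) (fun a => Instr.lift_updSim .inl (M₁.instr a))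
    (fun a => Instr.lift_predSim .inl (M₁.instr a)) i ρ w

theorem ok_rightWord (w : List M₂.Letter) :
    Instr.Ok f i ρ ((rightWord M₁ M₂ w).map (joinInstr M₁ M₂)) ↔
      Instr.Ok f i (ρ ∘ Sum.inr) (w.map M₂.instr) := by
  rw [rightWord, List.map_map]
  exact Instr.ok_sim (ι := Sum.inr) (fun a => Instr.lift_updSim .inr (M₂.instr a))
    (fun a => Instr.lift_predSim .inr (M₂.instr a)) i ρ w

theorem output_leftWord (w : List M₁.Letter) :
    Instr.output f i ρ ((leftWord M₁ M₂ w).map (joinInstr M₁ M₂)) =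
      Instr.output f i (ρ ∘ Sum.inl) (w.map M₁.instr) := by
  rw [leftWord, List.map_map]
  exact Instr.output_sim (ι := Sum.inl) (fun a => Instr.lift_updSim .inl (M₁.instr a))
    (fun a => Instr.lift_outSim .inl (M₁.instr a)) i ρ w

theorem output_rightWord (w : List M₂.Letter) :
    Instr.output f i ρ ((rightWord M₁ M₂ w).map (joinInstr M₁ M₂)) =
      Instr.output f i (ρ ∘ Sum.inr) (w.map M₂.instr) := by
  rw [rightWord, List.map_map]
  exact Instr.output_sim (ι := Sum.inr) (fun a => Instr.lift_updSim .inr (M₂.instr a))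
    (fun a => Instr.lift_outSim .inr (M₂.instr a)) i ρ w

/-- The second machine has to find its registers at their initial values when it starts, so the
first must leave them alone. -/
theorem mem_leftWord_comp_inr (w : List M₁.Letter) :
    Instr.mem f i ρ ((leftWord M₁ M₂ w).map (joinInstr M₁ M₂)) ∘ Sum.inr = ρ ∘ Sum.inr := by
  rw [leftWord, List.map_map]
  refine Instr.mem_of_forall_upd _ (fun a ha ρ x => ?_) i ρ
  obtain ⟨a, -, rfl⟩ := List.mem_map.1 ha
  exact Instr.lift_upd_comp .inl Sum.inr (fun _ _ => Sum.inl_ne_inr) (M₁.instr a) ρ x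

theorem mem_iff_exists_leftWord {w : List (Option (M₁.Letter ⊕ M₂.Letter))} {L} :
    w ∈ Language.map (some ∘ Sum.inl) L ↔ ∃ v ∈ L, leftWord M₁ M₂ v = w := Iff.rfl

theorem mem_iff_exists_rightWord {w : List (Option (M₁.Letter ⊕ M₂.Letter))} {L} :
    w ∈ Language.map (some ∘ Sum.inr) L ↔ ∃ v ∈ L, rightWord M₁ M₂ v = w := Iff.rfl

end Machine

theorem Language.nil_notMem_map {α β : Type*} {L : Language α} (h : [] ∉ L) (f : α → β) :
    [] ∉ Language.map f L := by
  rintro ⟨v, hv, h'⟩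
  exact h (List.map_eq_nil_iff.1 h' ▸ hv)

theorem Definable.union {Sch : T → Finset A} {F G : List (Event A D) → Set (ComplexEvent A D X)}
    (hF : Definable 𝒮 Preds Sch F) (hG : Definable 𝒮 Preds Sch G) :
    Definable 𝒮 Preds Sch fun S => F S ∪ G S := by
  obtain ⟨M₁, h₁⟩ := hF
  obtain ⟨M₂, h₂⟩ := hG
  refine .intro (M₁.joinInstr M₂) (Sum.elim M₁.init M₂.init)
    (Language.map (some ∘ Sum.inl) M₁.lang + Language.map (some ∘ Sum.inr) M₂.lang)
    ((M₁.regular.map _).add (M₂.regular.map _)) ?_ fun S hS C => ?_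
  · rw [Language.mem_add, not_or]
    exact ⟨Language.nil_notMem_map M₁.nil_notMem _, Language.nil_notMem_map M₂.nil_notMem _⟩
  rw [← h₁ S hS, ← h₂ S hS, Set.mem_union, Machine.mem_sem_iff, Machine.mem_sem_iff]
  constructor
  · rintro (⟨i, hi, w, hw, hn, hok, rfl⟩ | ⟨i, hi, w, hw, hn, hok, rfl⟩)
    · refine ⟨i, hi, M₁.leftWord M₂ w, Or.inl ⟨w, hw, rfl⟩, ?_⟩
      rw [Machine.length_leftWord, Machine.ok_leftWord, Machine.output_leftWord]
      exact ⟨hn, hok, rfl⟩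
    · refine ⟨i, hi, M₁.rightWord M₂ w, Or.inr ⟨w, hw, rfl⟩, ?_⟩
      rw [Machine.length_rightWord, Machine.ok_rightWord, Machine.output_rightWord]
      exact ⟨hn, hok, rfl⟩
  · rintro ⟨i, hi, w, hw, h⟩
    rcases (Language.mem_add _ _ _).1 hw with hw | hw
    · obtain ⟨v, hv, rfl⟩ := Machine.mem_iff_exists_leftWord.1 hw
      rw [Machine.length_leftWord, Machine.ok_leftWord, Machine.output_leftWord] at h
      exact Or.inl ⟨i, hi, v, hv, h⟩
    · obtain ⟨v, hv, rfl⟩ := Machine.mem_iff_exists_rightWord.1 hw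
      rw [Machine.length_rightWord, Machine.ok_rightWord, Machine.output_rightWord] at h
      exact Or.inr ⟨i, hi, v, hv, h⟩

/-- The word of the first machine is followed by idle instructions, then by the word of the second.
The gap set `{0}` gives `:`, and the set of all numbers gives `;`. -/
theorem Definable.link {Sch : T → Finset A} {F F' : List (Event A D) → Set (ComplexEvent A D X)}
    (hF : Definable 𝒮 Preds Sch F) (hF' : Definable 𝒮 Preds Sch F') {G : Set ℕ} (hG : IsGap G) :
    Definable 𝒮 Preds Sch fun S =>
      {C | ∃ C₁ ∈ F S, ∃ C₂ ∈ F' S, Link G C₁ C₂ ∧ C = C₁.union C₂} := by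
  obtain ⟨M₁, h₁⟩ := hF
  obtain ⟨M₂, h₂⟩ := hF'
  let p := M₁.joinInstr M₂
  let init : M₁.Reg ⊕ M₂.Reg → D := Sum.elim M₁.init M₂.init
  let wd : List M₁.Letter → ℕ → List M₂.Letter → List (Option (M₁.Letter ⊕ M₂.Letter)) :=
    fun w₁ m w₂ => M₁.leftWord M₂ w₁ ++ (List.replicate m none ++ M₁.rightWord M₂ w₂)
  have hlen : ∀ w₁ m w₂, (wd w₁ m w₂).length = w₁.length + m + w₂.length := by
    intro w₁ m w₂
    simp [wd, Machine.leftWord, Machine.rightWord, add_assoc]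
  have hll : ∀ w₁ : List M₁.Letter, ((M₁.leftWord M₂ w₁).map p).length = w₁.length := by
    simp [Machine.leftWord]
  have hrep : ∀ m, (List.replicate m none).map p = List.replicate m .skip := fun m => by
    rw [List.map_replicate]
    rfl
  have hok : ∀ S i w₁ m w₂, Instr.Ok (𝒮.inputs S) i init ((wd w₁ m w₂).map p) ↔
      M₁.Ok S i w₁ ∧ M₂.Ok S (i + w₁.length + m) w₂ := by
    intro S i w₁ m w₂
    rw [List.map_append, List.map_append, hrep, Instr.ok_append, Instr.ok_append, hll,
      List.length_replicate, Instr.mem_replicate_skip, Machine.ok_leftWord, Machine.ok_rightWord,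
      Machine.mem_leftWord_comp_inr, and_iff_right (Instr.ok_replicate_skip _ _ _)]
    rfl
  have hout : ∀ S i w₁ m w₂, Instr.output (𝒮.inputs S) i init ((wd w₁ m w₂).map p) =
      M₁.output S i w₁ + M₂.output S (i + w₁.length + m) w₂ := by
    intro S i w₁ m w₂
    rw [List.map_append, List.map_append, hrep, Instr.output_append, Instr.output_append, hll,
      List.length_replicate, Instr.mem_replicate_skip, Machine.output_leftWord,
      Machine.output_rightWord, Machine.mem_leftWord_comp_inr, Instr.output_replicate_skip,
      zero_add]
    rfl
  let L : Language (Option (M₁.Letter ⊕ M₂.Letter)) := Language.map (some ∘ Sum.inl) M₁.lang *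
    (Language.gap none G * Language.map (some ∘ Sum.inr) M₂.lang)
  have hmem : ∀ w, w ∈ L ↔
      ∃ w₁ ∈ M₁.lang, ∃ m ∈ G, ∃ w₂ ∈ M₂.lang, w = wd w₁ m w₂ := by
    intro w
    constructor
    · rintro ⟨_, ⟨w₁, hw₁, rfl⟩, _, ⟨_, ⟨m, hm, rfl⟩, _, ⟨w₂, hw₂, rfl⟩, rfl⟩, rfl⟩
      exact ⟨w₁, hw₁, m, hm, w₂, hw₂, rfl⟩
    · rintro ⟨w₁, hw₁, m, hm, w₂, hw₂, rfl⟩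
      exact ⟨_, ⟨w₁, hw₁, rfl⟩, _, ⟨_, ⟨m, hm, rfl⟩, _, ⟨w₂, hw₂, rfl⟩, rfl⟩, rfl⟩
  refine .intro p init L ((M₁.regular.map _).mul ((hG none).mul (M₂.regular.map _))) ?_
    fun S hS C => ?_
  · rw [hmem]
    rintro ⟨w₁, hw₁, m, -, w₂, -, h⟩
    have h' := hlen w₁ m w₂
    rw [← h, List.length_nil] at h'
    have := M₁.length_pos hw₁
    omega
  rw [← h₁ S hS, ← h₂ S hS]
  constructor
  · rintro ⟨_, h1, _, h2, hl, rfl⟩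
    obtain ⟨i, hi, w₁, hw₁, hn, ho₁, rfl⟩ := Machine.mem_sem_iff.1 h1
    obtain ⟨j, hj, w₂, hw₂, hn', ho₂, rfl⟩ := Machine.mem_sem_iff.1 h2
    have hp₁ := M₁.length_pos hw₁
    have hp₂ := M₂.length_pos hw₂
    obtain ⟨m, hm, rfl⟩ := (link_span hp₁).1 hl
    refine ⟨i, hi, wd w₁ m w₂, (hmem _).2 ⟨w₁, hw₁, m, hm, w₂, hw₂, rfl⟩, ?_,
      (hok S i w₁ m w₂).2 ⟨ho₁, ho₂⟩, ?_⟩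
    · rw [hlen]
      omega
    · rw [union_span hp₁ hp₂, hlen, ← hout]
  · rintro ⟨i, hi, w, hw, hn, ho, rfl⟩
    obtain ⟨w₁, hw₁, m, hm, w₂, hw₂, rfl⟩ := (hmem w).1 hw
    have hp₁ := M₁.length_pos hw₁
    have hp₂ := M₂.length_pos hw₂
    have ho' := (hok S i w₁ m w₂).1 ho
    rw [hlen] at hn
    refine ⟨_, Machine.mem_sem_iff.2 ⟨i, hi, w₁, hw₁, by omega, ho'.1, rfl⟩, _,
      Machine.mem_sem_iff.2 ⟨i + w₁.length + m, by omega, w₂, hw₂, by omega, ho'.2, rfl⟩,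
      (link_span hp₁).2 ⟨m, hm, rfl⟩, ?_⟩
    rw [union_span hp₁ hp₂, hlen, ← hout]

/-! #### Iteration -/

namespace Machine

variable (M : Machine 𝒮 Preds)

/-- The instructions of a machine, with a mark for those that first reset the registers, and the
instruction `skip`. -/
def iterInstr : Option (M.Letter × Bool) → Instr 𝒮 Preds M.Reg
  | none => .skip
  | some (a, b) =>
    { M.instr a with
      upd := fun ρ x => (M.instr a).upd (if b then M.init else ρ) x
      expressible := fun v => (M.instr a |>.expressible v).comp
        (s := fun ρ _ => if b then M.init else ρ) fun v => by
          cases b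
          · exact .reg v
          · exact .const (M.init v) }

/-- The words of a machine with a mark at the head. -/
def headWord (w : List M.Letter) : List (Option (M.Letter × Bool)) := w.markHead.map some

theorem length_headWord (w : List M.Letter) : (M.headWord w).length = w.length := by
  cases w <;> simp [headWord, List.markHead]

variable {M} {S : List (Event A D)} {w : List M.Letter} (i : ℕ) (ρ : M.Reg → D)

/-- The head of the block resets the registers, so whatever earlier blocks left in `ρ` is forgotten.
-/
theorem ok_headWord (hw : w ∈ M.lang) :
    Instr.Ok (𝒮.inputs S) i ρ ((M.headWord w).map M.iterInstr) ↔ M.Ok S i w := by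
  rcases w with _ | ⟨a, w⟩
  · exact absurd hw M.nil_notMem
  refine and_congr Iff.rfl ?_
  rw [List.map_map, List.map_map]
  exact Instr.ok_sim (ι := id) (p := M.instr) (fun _ _ _ => rfl) (fun _ _ _ => Iff.rfl) _ _ w

theorem output_headWord (hw : w ∈ M.lang) :
    Instr.output (𝒮.inputs S) i ρ ((M.headWord w).map M.iterInstr) = M.output S i w := by
  rcases w with _ | ⟨a, w⟩
  · exact absurd hw M.nil_notMem
  refine congrArg₂ (· + ·) rfl ?_
  rw [List.map_map, List.map_map]
  refine Instr.output_sim (ι := id) (p := M.instr) (fun _ _ _ => rfl) (fun a Z => ?_) _ _ w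
  refine (Multiset.map_id ((M.instr a).out Z)).symm.trans (Multiset.map_congr rfl fun r _ => ?_)
  ext1
  funext b
  simp

end Machine

/-- A word of the iteration consists of blocks with marked heads, separated by gaps. One copy of the
registers serves all blocks. -/
theorem Definable.iter {Sch : T → Finset A} {F : List (Event A D) → Set (ComplexEvent A D X)}
    (hF : Definable 𝒮 Preds Sch F) {G : Set ℕ} (hG : IsGap G) :
    Definable 𝒮 Preds Sch fun S => {C | Iter (Link G) (F S) C} := by
  obtain ⟨M, hM⟩ := hF
  let K : Language (Option (M.Letter × Bool)) := Language.map some M.lang.markHead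
  have hK : K.IsRegular := (M.regular.markHead M.nil_notMem).map _
  have hmemK : ∀ w, w ∈ K ↔ ∃ v ∈ M.lang, w = M.headWord v := by
    intro w
    constructor
    · rintro ⟨_, ⟨v, hv, rfl⟩, rfl⟩
      exact ⟨v, hv, rfl⟩
    · rintro ⟨v, hv, rfl⟩
      exact ⟨_, ⟨v, hv, rfl⟩, rfl⟩
  have hrep : ∀ m, (List.replicate m none).map M.iterInstr = List.replicate m .skip := fun m => by
    rw [List.map_replicate]
    rfl
  let L := K * (Language.gap none G * K)∗
  have hmemL : ∀ w, w ∈ L ↔ ∃ v ∈ M.lang, (w = M.headWord v ∨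
      ∃ m ∈ G, ∃ w' ∈ L, w = M.headWord v ++ (List.replicate m none ++ w')) := by
    -- Unfolding the star once gives the recursion that defines `Iter`.
    have hL : L = K + K * (Language.gap none G * L) := by
      change K * (Language.gap none G * K)∗ = K + K * (_ * (K * (Language.gap none G * K)∗))
      nth_rw 1 [← Language.one_add_self_mul_kstar_eq_kstar]
      rw [mul_add, mul_one, mul_assoc]
    intro w
    rw [hL, Language.mem_add]
    constructor
    · rintro (hw | ⟨_, hv, _, ⟨_, ⟨m, hm, rfl⟩, w', hw', rfl⟩, rfl⟩)
      · obtain ⟨v, hv, rfl⟩ := (hmemK _).1 hw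
        exact ⟨v, hv, Or.inl rfl⟩
      · obtain ⟨v, hv', rfl⟩ := (hmemK _).1 hv
        exact ⟨v, hv', Or.inr ⟨m, hm, w', hL ▸ hw', rfl⟩⟩
    · rintro ⟨v, hv, rfl | ⟨m, hm, w', hw', rfl⟩⟩
      · exact Or.inl ((hmemK _).2 ⟨v, hv, rfl⟩)
      · exact Or.inr ⟨_, (hmemK _).2 ⟨v, hv, rfl⟩, _, ⟨_, ⟨m, hm, rfl⟩, w', hL ▸ hw', rfl⟩, rfl⟩
  have hpos : ∀ w ∈ L, 0 < w.length := by
    intro w hw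
    obtain ⟨v, hv, h⟩ := (hmemL w).1 hw
    have := M.length_pos hv
    rcases h with rfl | ⟨m, -, w', -, rfl⟩
    · rwa [M.length_headWord]
    · rw [List.length_append, M.length_headWord]
      omega
  -- The witness `ρ'` is the register content left by the first block; only its existence matters.
  have hstep : ∀ S i ρ v m w', v ∈ M.lang → ∃ ρ',
      (Instr.Ok (𝒮.inputs S) i ρ
        ((M.headWord v ++ (List.replicate m none ++ w')).map M.iterInstr) ↔
        M.Ok S i v ∧ Instr.Ok (𝒮.inputs S) (i + v.length + m) ρ' (w'.map M.iterInstr)) ∧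
      Instr.output (𝒮.inputs S) i ρ
        ((M.headWord v ++ (List.replicate m none ++ w')).map M.iterInstr) =
        M.output S i v + Instr.output (𝒮.inputs S) (i + v.length + m) ρ' (w'.map M.iterInstr) := by
    intro S i ρ v m w' hv
    refine ⟨Instr.mem (𝒮.inputs S) i ρ ((M.headWord v).map M.iterInstr), ?_, ?_⟩
    · rw [List.map_append, List.map_append, hrep, Instr.ok_append, Instr.ok_append,
        List.length_map, M.length_headWord, List.length_replicate, Instr.mem_replicate_skip,
        Machine.ok_headWord _ _ hv, and_iff_right (Instr.ok_replicate_skip _ _ _)]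
    · rw [List.map_append, List.map_append, hrep, Instr.output_append, Instr.output_append,
        List.length_map, M.length_headWord, List.length_replicate, Instr.mem_replicate_skip,
        Machine.output_headWord _ _ hv, Instr.output_replicate_skip, zero_add]
  refine .intro M.iterInstr M.init L (hK.mul ((hG none).mul hK).kstar)
    (fun h => lt_irrefl 0 (hpos _ h)) fun S hS C => ?_
  rw [← hM S hS]
  refine Iff.symm ⟨?_, ?_⟩
  · rintro ⟨i, hi, w, hw, hn, hok, rfl⟩
    -- Later blocks start from leftover register values, so the induction must allow every `ρ`.
    have hmain : ∀ n, ∀ w ∈ L, w.length = n → ∀ i ρ, 1 ≤ i → i + w.length ≤ S.length + 1 →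
        Instr.Ok (𝒮.inputs S) i ρ (w.map M.iterInstr) → Iter (Link G) (M.sem S)
          (span i w.length (Instr.output (𝒮.inputs S) i ρ (w.map M.iterInstr))) := by
      intro n
      induction n using Nat.strong_induction_on with
      | _ n ih =>
        rintro w hw rfl i ρ hi hn hok
        obtain ⟨v, hv, rfl | ⟨m, hm, w', hw', rfl⟩⟩ := (hmemL w).1 hw
        · rw [M.length_headWord] at hn ⊢
          rw [Machine.ok_headWord _ _ hv] at hok
          rw [Machine.output_headWord _ _ hv]
          exact .base (Machine.mem_sem_iff.2 ⟨i, hi, v, hv, hn, hok, rfl⟩)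
        · obtain ⟨ρ', h1, h2⟩ := hstep S i ρ v m w' hv
          have hv' := M.length_pos hv
          have hl : (M.headWord v ++ (List.replicate m none ++ w')).length =
              v.length + m + w'.length := by
            simp [M.length_headWord, add_assoc]
          rw [hl] at hn
          have hok' := h1.1 hok
          rw [h2, hl, ← union_span hv' (hpos w' hw')]
          refine .step (Machine.mem_sem_iff.2 ⟨i, hi, v, hv, by omega, hok'.1, rfl⟩)
            (ih _ (by omega) w' hw' rfl _ _ (by omega) (by omega) hok'.2)
            ((link_span hv').2 ⟨m, hm, rfl⟩)
    exact hmain _ w hw rfl i M.init hi hn hok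
  · intro hC
    -- For the same reason the word must yield the bags `μ` from all register values, not only from
    -- the initial ones.
    have hmain : ∃ i, 1 ≤ i ∧ ∃ w ∈ L, i + w.length ≤ S.length + 1 ∧ ∃ μ, C = span i w.length μ ∧
        ∀ ρ, Instr.Ok (𝒮.inputs S) i ρ (w.map M.iterInstr) ∧
          μ = Instr.output (𝒮.inputs S) i ρ (w.map M.iterInstr) := by
      induction hC with
      | base h =>
        obtain ⟨i, hi, v, hv, hn, hok, rfl⟩ := Machine.mem_sem_iff.1 h
        refine ⟨i, hi, M.headWord v, (hmemL _).2 ⟨v, hv, Or.inl rfl⟩, ?_, M.output S i v, ?_,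
          fun ρ => ⟨(Machine.ok_headWord _ _ hv).2 hok, (Machine.output_headWord _ _ hv).symm⟩⟩
        · rwa [M.length_headWord]
        · rw [M.length_headWord]
      | step h₁ _ h ih =>
        obtain ⟨i, hi, v, hv, hn, hok, rfl⟩ := Machine.mem_sem_iff.1 h₁
        obtain ⟨j, hj, w', hw', hn', μ, rfl, hμ⟩ := ih
        have hv' := M.length_pos hv
        obtain ⟨m, hm, rfl⟩ := (link_span hv').1 h
        have hl : (M.headWord v ++ (List.replicate m none ++ w')).length =
            v.length + m + w'.length := by
          simp [M.length_headWord, add_assoc]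
        refine ⟨i, hi, M.headWord v ++ (List.replicate m none ++ w'),
          (hmemL _).2 ⟨v, hv, Or.inr ⟨m, hm, w', hw', rfl⟩⟩, by omega, M.output S i v + μ, ?_,
          fun ρ => ?_⟩
        · rw [hl, union_span hv' (hpos w' hw')]
        · obtain ⟨ρ', h1, h2⟩ := hstep S i ρ v m w' hv
          exact ⟨h1.2 ⟨hok, (hμ ρ').1⟩, h2 ▸ (hμ ρ').2 ▸ rfl⟩
    obtain ⟨i, hi, w, hw, hn, μ, rfl, hμ⟩ := hmain
    exact ⟨i, hi, w, hw, hn, (hμ _).1, congrArg _ (hμ M.init).2⟩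

end

section

variable {A : Type u} {D T X : Type*} {k : ℕ} {𝒮 : Setting A D T X k}
  {Preds : Set (Set (Event A D))}

open ComplexEvent

/-! #### Conjunction -/

/-- Filtering by `p` recovers the first summand. In the application `p` says that an event has the
time of the current position. -/
theorem Multiset.add_inj_of_forall {α : Type*} {b₁ b₂ m₁ m₂ : Multiset α} (p : α → Prop)
    (hb₁ : ∀ e ∈ b₁, p e) (hb₂ : ∀ e ∈ b₂, p e) (hm₁ : ∀ e ∈ m₁, ¬ p e) (hm₂ : ∀ e ∈ m₂, ¬ p e) :
    b₁ + m₁ = b₂ + m₂ ↔ b₁ = b₂ ∧ m₁ = m₂ := by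
  classical
  refine ⟨fun h => ?_, fun h => h.1 ▸ h.2 ▸ rfl⟩
  have hb : b₁ = b₂ := by
    have := congrArg (Multiset.filter p) h
    rwa [Multiset.filter_add, Multiset.filter_add, Multiset.filter_eq_self.2 hb₁,
      Multiset.filter_eq_self.2 hb₂, Multiset.filter_eq_nil.2 hm₁, Multiset.filter_eq_nil.2 hm₂,
      add_zero, add_zero] at this
  subst hb
  exact ⟨rfl, add_left_cancel h⟩

namespace Machine

/-- Both instructions are executed on disjoint registers, and their outputs have to be equal. -/
def bothInstr [Finite X] (M₁ M₂ : Machine 𝒮 Preds) (a : M₁.Letter × M₂.Letter) :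
    Instr 𝒮 Preds (M₁.Reg ⊕ M₂.Reg) where
  upd ρ x := Sum.elim ((M₁.instr a.1).upd (ρ ∘ Sum.inl) x) ((M₂.instr a.2).upd (ρ ∘ Sum.inr) x)
  pred := ({x | (x.1 ∘ Sum.inl, x.2) ∈ (M₁.instr a.1).pred} ∩
    {x | (x.1 ∘ Sum.inr, x.2) ∈ (M₂.instr a.2).pred}) ∩
    {x | ∀ Z, (M₁.instr a.1).emit (x.1 ∘ Sum.inl) x.2 Z = (M₂.instr a.2).emit (x.1 ∘ Sum.inr) x.2 Z}
  -- The output of one machine suffices, since the test forces both outputs to coincide.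
  out Z := ((M₁.instr a.1).out Z).map (PMap.map Sum.inl)
  expressible v := by
    rcases v with v | v
    · exact ((M₁.instr a.1).expressible v).comp (s := fun ρ _ => ρ ∘ Sum.inl) fun v => .reg _
    · exact ((M₂.instr a.2).expressible v).comp (s := fun ρ _ => ρ ∘ Sum.inr) fun v => .reg _
  testable := by
    refine .inter (.inter ((M₁.instr a.1).testable.comap _) ((M₂.instr a.2).testable.comap _)) ?_
    have := Fintype.ofFinite X
    have h := Testable.forall_mem_finset (Preds := Preds) (Finset.univ : Finset X)
      (V := M₁.Reg ⊕ M₂.Reg) (D := D)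
      (p := fun Z x => (M₁.instr a.1).emit (x.1 ∘ Sum.inl) x.2 Z =
        (M₂.instr a.2).emit (x.1 ∘ Sum.inr) x.2 Z) fun Z _ =>
      Testable.map_eq_map _ _ fun r s => by
        have := Testable.map_event_eq (Preds := Preds) (r.map Sum.inl) (s.map Sum.inr)
        simpa only [PMap.map_map] using this
    simpa only [Finset.mem_univ, true_implies] using h

variable [Finite X] {M₁ M₂ : Machine 𝒮 Preds} {f : ℕ → A → D}

/-- The tests compare outputs at each position, which amounts to comparing the total outputs: events
emitted now have time `i`, all later ones a greater time. -/
theorem ok_both (i : ℕ) (ρ : M₁.Reg ⊕ M₂.Reg → D) (w : List (M₁.Letter × M₂.Letter)) :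
    Instr.Ok f i ρ (w.map (bothInstr M₁ M₂)) ↔
      Instr.Ok f i (ρ ∘ Sum.inl) ((w.map Prod.fst).map M₁.instr) ∧
      Instr.Ok f i (ρ ∘ Sum.inr) ((w.map Prod.snd).map M₂.instr) ∧
      Instr.output f i (ρ ∘ Sum.inl) ((w.map Prod.fst).map M₁.instr) =
        Instr.output f i (ρ ∘ Sum.inr) ((w.map Prod.snd).map M₂.instr) := by
  induction w generalizing i ρ with
  | nil => simp [Instr.Ok, Instr.output]
  | cons a w ih =>
    simp only [List.map_cons, Instr.Ok, Instr.output, ih]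
    set ρ₁ := (M₁.instr a.1).upd (ρ ∘ Sum.inl) (f i) with h₁
    set ρ₂ := (M₂.instr a.2).upd (ρ ∘ Sum.inr) (f i) with h₂
    have hl : (bothInstr M₁ M₂ a).upd ρ (f i) ∘ Sum.inl = ρ₁ := rfl
    have hr : (bothInstr M₁ M₂ a).upd ρ (f i) ∘ Sum.inr = ρ₂ := rfl
    have hp : ((bothInstr M₁ M₂ a).upd ρ (f i), i) ∈ (bothInstr M₁ M₂ a).pred ↔
        ((ρ₁, i) ∈ (M₁.instr a.1).pred ∧ (ρ₂, i) ∈ (M₂.instr a.2).pred) ∧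
        ∀ Z, (M₁.instr a.1).emit ρ₁ i Z = (M₂.instr a.2).emit ρ₂ i Z := Iff.rfl
    rw [hl, hr, hp]
    have hout : ∀ (μ : List (Instr 𝒮 Preds M₁.Reg)) (ν : List (Instr 𝒮 Preds M₂.Reg)),
        (M₁.instr a.1).emit ρ₁ i +
        Instr.output f (i + 1) ρ₁ μ = (M₂.instr a.2).emit ρ₂ i + Instr.output f (i + 1) ρ₂ ν ↔
        (∀ Z, (M₁.instr a.1).emit ρ₁ i Z = (M₂.instr a.2).emit ρ₂ i Z) ∧
        Instr.output f (i + 1) ρ₁ μ = Instr.output f (i + 1) ρ₂ ν := by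
      intro μ ν
      simp only [funext_iff, Pi.add_apply, ← forall_and]
      refine forall_congr' fun Z => Multiset.add_inj_of_forall (fun e => e.time = i)
        (fun e he => ?_) (fun e he => ?_) (fun e he => ?_) (fun e he => ?_)
      · obtain ⟨r, -, rfl⟩ := Multiset.mem_map.1 he
        rfl
      · obtain ⟨r, -, rfl⟩ := Multiset.mem_map.1 he
        rfl
      · have := Instr.le_time_of_mem_output he
        omega
      · have := Instr.le_time_of_mem_output he
        omega
    rw [hout]
    tauto

theorem output_both (i : ℕ) (ρ : M₁.Reg ⊕ M₂.Reg → D) (w : List (M₁.Letter × M₂.Letter)) :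
    Instr.output f i ρ (w.map (bothInstr M₁ M₂)) =
      Instr.output f i (ρ ∘ Sum.inl) ((w.map Prod.fst).map M₁.instr) := by
  rw [List.map_map]
  exact Instr.output_sim (ι := Sum.inl) (p := M₁.instr ∘ Prod.fst)
    (fun _ _ _ => rfl) (fun _ _ => rfl) i ρ w

end Machine

theorem Definable.inter [Finite X] {Sch : T → Finset A}
    {F G : List (Event A D) → Set (ComplexEvent A D X)} (hF : Definable 𝒮 Preds Sch F)
    (hG : Definable 𝒮 Preds Sch G) : Definable 𝒮 Preds Sch fun S => F S ∩ G S := by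
  obtain ⟨M₁, h₁⟩ := hF
  obtain ⟨M₂, h₂⟩ := hG
  refine .intro (M₁.bothInstr M₂) (Sum.elim M₁.init M₂.init)
    (Language.comap Prod.fst M₁.lang ⊓ Language.comap Prod.snd M₂.lang)
    ((M₁.regular.comap _).inf (M₂.regular.comap _)) (fun h => M₁.nil_notMem h.1) fun S hS C => ?_
  rw [← h₁ S hS, ← h₂ S hS, Set.mem_inter_iff, Machine.mem_sem_iff, Machine.mem_sem_iff]
  constructor
  · rintro ⟨⟨i, hi, w₁, hw₁, hn, ho₁, rfl⟩, j, -, w₂, hw₂, -, ho₂, h⟩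
    -- Equal complex events have equal starts and lengths, so zipping the two words loses nothing.
    obtain ⟨rfl, hl, hout⟩ := span_inj (M₁.length_pos hw₁) (M₂.length_pos hw₂) h
    have hz₁ : (w₁.zip w₂).map Prod.fst = w₁ := List.map_fst_zip hl.le
    have hz₂ : (w₁.zip w₂).map Prod.snd = w₂ := List.map_snd_zip hl.ge
    have hz : (w₁.zip w₂).length = w₁.length := by rw [← List.length_map Prod.fst, hz₁]
    refine ⟨i, hi, w₁.zip w₂, Language.mem_inf.2 ⟨?_, ?_⟩, ?_⟩
    · rwa [Language.mem_comap, hz₁]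
    · rwa [Language.mem_comap, hz₂]
    · rw [Machine.ok_both, Machine.output_both, hz₁, hz₂, hz]
      exact ⟨hn, ⟨ho₁, ho₂, hout⟩, rfl⟩
  · rintro ⟨i, hi, w, hw, hn, ho, rfl⟩
    obtain ⟨hw₁, hw₂⟩ := Language.mem_inf.1 hw
    obtain ⟨ho₁, ho₂, hout⟩ := (Machine.ok_both ..).1 ho
    rw [Machine.output_both]
    refine ⟨⟨i, hi, _, hw₁, ?_, ho₁, ?_⟩, i, hi, _, hw₂, ?_, ho₂, ?_⟩
    · rwa [List.length_map]
    · rw [List.length_map]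
      rfl
    · rwa [List.length_map]
    · rw [List.length_map, hout]
      rfl

/-! #### Aggregation -/

theorem PMap.dom_finite {α β : Type*} (p : PMap α β) : p.dom.Finite := p.finite_dom

namespace Machine

/-- The subscript of an aggregation for an attribute that it defines. -/
def sub (s : PMap A (Fin k × X × A)) (b : s.dom) : Fin k × X × A :=
  (s b.1).get b.2

/-- The mapping that reads the results of an aggregation from additional registers. -/
noncomputable def aggRenaming (V : Type u) (s : PMap A (Fin k × X × A)) : PMap A (V ⊕ s.dom) :=
  (PMap.idOn s.dom s.dom_finite).map Sum.inr

open Classical in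
/-- The instructions of a machine that accumulate the results of an aggregation in additional
registers; a marked instruction outputs them. -/
noncomputable def aggInstr (M : Machine 𝒮 Preds) (Y : X) (s : PMap A (Fin k × X × A))
    (a : M.Letter × Bool) : Instr 𝒮 Preds (M.Reg ⊕ s.dom) where
  upd ρ x := Sum.elim ((M.instr a.1).upd (ρ ∘ Sum.inl) x) fun b =>
    (𝒮.monoid (sub s b).1).mul (ρ (Sum.inr b)) (𝒮.aggregate (sub s b).1
      -- The time 0 is a dummy: an update does not know its position, and aggregates read only
      -- attribute values.
      ((M.instr a.1).emit ((M.instr a.1).upd (ρ ∘ Sum.inl) x) 0 (sub s b).2.1) (sub s b).2.2)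
  pred := {x | (x.1 ∘ Sum.inl, x.2) ∈ (M.instr a.1).pred}
  out Z := ((M.instr a.1).out Z).map (PMap.map Sum.inl) +
    if a.2 ∧ Z = Y then {aggRenaming M.Reg s} else 0
  expressible v := by
    have hl : ∀ v, 𝒮.Expressible fun (ρ : M.Reg ⊕ s.dom → D) x =>
        (M.instr a.1).upd (ρ ∘ Sum.inl) x v := fun v =>
      ((M.instr a.1).expressible v).comp (s := fun ρ _ => ρ ∘ Sum.inl) fun v => .reg _
    rcases v with v | b
    · exact hl v
    · refine .op _ (.reg _) ?_
      simp only [Setting.aggregate, Instr.emit, Multiset.map_map]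
      refine .multiset_prod _ _ fun r => ?_
      simp only [Function.comp_def, Setting.val, PMap.map_apply]
      rcases r (sub s b).2.2 with _ | v
      · exact .const _
      · exact hl v
  testable := (M.instr a.1).testable.comap _

variable {M : Machine 𝒮 Preds} {f : ℕ → A → D} {Y : X} {s : PMap A (Fin k × X × A)}

theorem ok_agg (i : ℕ) (ρ : M.Reg ⊕ s.dom → D) (w : List (M.Letter × Bool)) :
    Instr.Ok f i ρ (w.map (M.aggInstr Y s)) ↔
      Instr.Ok f i (ρ ∘ Sum.inl) ((w.map Prod.fst).map M.instr) := by
  rw [List.map_map]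
  exact Instr.ok_sim (ι := Sum.inl) (p := M.instr ∘ Prod.fst)
    (fun _ _ _ => rfl) (fun _ _ _ => Iff.rfl) i ρ w

theorem aggregate_add (j : Fin k) (B B' : Multiset (Event A D)) (a : A) :
    𝒮.aggregate j (B + B') a = (𝒮.monoid j).mul (𝒮.aggregate j B a) (𝒮.aggregate j B' a) := by
  let _ := 𝒮.monoid j
  simp only [Setting.aggregate, Multiset.map_add, Multiset.prod_add]
  rfl

theorem aggregate_emit {V : Type u} (j : Fin k) (a : Instr 𝒮 Preds V) (ρ : V → D) (i i' : ℕ)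
    (Z : X) (b : A) :
    𝒮.aggregate j (a.emit ρ i Z) b = 𝒮.aggregate j (a.emit ρ i' Z) b := by
  simp only [Setting.aggregate, Instr.emit, Multiset.map_map]
  rfl

/-- Each position multiplies the register by the aggregate of the bag it emits; associativity merges
these factors into the aggregate of the total bag. -/
theorem mem_agg (i : ℕ) (ρ : M.Reg ⊕ s.dom → D) (w : List (M.Letter × Bool)) (b : s.dom) :
    Instr.mem f i ρ (w.map (M.aggInstr Y s)) (Sum.inr b) =
      (𝒮.monoid (sub s b).1).mul (ρ (Sum.inr b)) (𝒮.aggregate (sub s b).1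
        (Instr.output f i (ρ ∘ Sum.inl) ((w.map Prod.fst).map M.instr) (sub s b).2.1)
        (sub s b).2.2) := by
  let _ := 𝒮.monoid (sub s b).1
  induction w generalizing i ρ with
  | nil =>
    exact (mul_one (ρ (Sum.inr b))).symm
  | cons a w ih =>
    simp only [List.map_cons, Instr.mem, Instr.output, ih, Pi.add_apply, aggregate_add]
    rw [aggregate_emit _ _ _ i 0]
    exact mul_assoc _ _ _

open Classical in
theorem emit_agg (a : M.Letter × Bool) (ρ : M.Reg ⊕ s.dom → D) (i : ℕ) (Z : X) :
    (M.aggInstr Y s a).emit ρ i Z = (M.instr a.1).emit (ρ ∘ Sum.inl) i Z +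
      if a.2 ∧ Z = Y then {⟨(aggRenaming M.Reg s).map ρ, i⟩} else 0 := by
  simp only [Instr.emit, aggInstr, Multiset.map_add, Multiset.map_map, Function.comp_def,
    PMap.map_map]
  congr 1
  split_ifs <;> rfl

open Classical in
theorem output_agg (i : ℕ) (ρ : M.Reg ⊕ s.dom → D) (v : List M.Letter) (a : M.Letter) (Z : X) :
    Instr.output f i ρ ((v.map (·, false) ++ [(a, true)]).map (M.aggInstr Y s)) Z =
      Instr.output f i (ρ ∘ Sum.inl) ((v ++ [a]).map M.instr) Z +
      if Z = Y then {⟨(aggRenaming M.Reg s).map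
        (Instr.mem f i ρ ((v.map (·, false) ++ [(a, true)]).map (M.aggInstr Y s))),
        i + v.length⟩} else 0 := by
  have hu : ∀ a, Instr.UpdSim Sum.inl (M.aggInstr Y s (a, false)) (M.instr a) := fun _ _ _ => rfl
  have hu' : Instr.UpdSim Sum.inl (M.aggInstr Y s (a, true)) (M.instr a) := fun _ _ => rfl
  have hm := Instr.mem_sim (f := f) hu i ρ v
  have ho := Instr.output_sim (f := f) hu (fun a Z => by simp [aggInstr]) i ρ v
  simp only [List.map_append, List.map_map, Function.comp_def, List.map_cons, List.map_nil,
    Instr.output_append, Instr.mem_append, Pi.add_apply, Instr.output, Instr.mem, List.length_map,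
    add_zero, add_assoc]
  -- Emission reads the updated registers, so the aggregate includes the contribution of the last
  -- position.
  rw [ho, emit_agg, hu', hm]
  simp only [true_and, Function.comp_def]

/-- The initial values of the registers for an aggregation. -/
def aggInit (M : Machine 𝒮 Preds) (s : PMap A (Fin k × X × A)) : M.Reg ⊕ s.dom → D :=
  Sum.elim M.init fun b => (𝒮.monoid (sub s b).1).one

theorem map_aggRenaming {ρ : M.Reg ⊕ s.dom → D} {μ : X → Multiset (Event A D)}
    (h : ∀ b, ρ (Sum.inr b) = 𝒮.aggregate (sub s b).1 (μ (sub s b).2.1) (sub s b).2.2) :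
    (aggRenaming M.Reg s).map ρ = s.map fun x => 𝒮.aggregate x.1 (μ x.2.1) x.2.2 := by
  ext1
  funext b
  change (((PMap.idOn s.dom s.dom_finite) b).map Sum.inr).map ρ = (s b).map _
  by_cases hb : b ∈ s.dom
  · obtain ⟨x, hx⟩ := Option.isSome_iff_exists.1 (show (s b).isSome from hb)
    have hs : sub s ⟨b, hb⟩ = x := by simp [sub, hx]
    rw [PMap.idOn_of_mem _ hb, hx, Option.map_some, Option.map_some, Option.map_some, h, hs]
  · have hx : s b = none := Option.not_isSome_iff_eq_none.1 hb
    rw [PMap.idOn_of_notMem _ hb, hx]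
    rfl

end Machine

theorem Definable.agg {Sch : T → Finset A} {F : List (Event A D) → Set (ComplexEvent A D X)}
    (hF : Definable 𝒮 Preds Sch F) (Y : X) (s : PMap A (Fin k × X × A)) :
    Definable 𝒮 Preds Sch fun S => {C | ∃ C' ∈ F S, C.start = C'.start ∧ C.finish = C'.finish ∧
      C.bag Y = C'.bag Y + {𝒮.aggEvent s C'} ∧ ∀ Z, Z ≠ Y → C.bag Z = C'.bag Z} := by
  classical
  obtain ⟨M, hM⟩ := hF
  have := s.finite_dom.to_subtype
  have : Finite s.dom := this
  refine .intro (M.aggInstr Y s) (M.aggInit s) M.lang.markLast M.regular.markLast ?_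
    fun S hS C => ?_
  · rintro ⟨v, a, -, h⟩
    simp at h
  have hok : ∀ i v a, Instr.Ok (𝒮.inputs S) i (M.aggInit s)
      ((v.map (·, false) ++ [(a, true)]).map (M.aggInstr Y s)) ↔ M.Ok S i (v ++ [a]) := by
    intro i v a
    rw [Machine.ok_agg]
    simp [Machine.Ok, Function.comp_def]
    rfl
  have hout : ∀ i v a, Instr.output (𝒮.inputs S) i (M.aggInit s)
      ((v.map (·, false) ++ [(a, true)]).map (M.aggInstr Y s)) =
      Function.update (M.output S i (v ++ [a])) Y (M.output S i (v ++ [a]) Y +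
        {𝒮.aggEvent s (span i (v.length + 1) (M.output S i (v ++ [a])))}) := by
    intro i v a
    have hmem : ∀ b, Instr.mem (𝒮.inputs S) i (M.aggInit s)
        ((v.map (·, false) ++ [(a, true)]).map (M.aggInstr Y s)) (Sum.inr b) =
        𝒮.aggregate (Machine.sub s b).1 (M.output S i (v ++ [a]) (Machine.sub s b).2.1)
          (Machine.sub s b).2.2 := by
      intro b
      let _ := 𝒮.monoid (Machine.sub s b).1
      rw [Machine.mem_agg]
      -- The additional registers start with the identity of their monoid.
      refine (one_mul _).trans ?_
      simp [Machine.output, Function.comp_def]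
      rfl
    funext Z
    rw [Machine.output_agg, Machine.map_aggRenaming hmem]
    by_cases h : Z = Y
    · subst h
      simp only [if_true, Function.update_self]
      rfl
    · simp only [h, if_false, Function.update_of_ne h, add_zero]
      rfl
  rw [← hM S hS]
  constructor
  · rintro ⟨C', hC', h1, h2, h3, h4⟩
    obtain ⟨i, hi, w, hw, hn, ho, rfl⟩ := Machine.mem_sem_iff.1 hC'
    rcases w.eq_nil_or_concat' with rfl | ⟨v, a, rfl⟩
    · exact absurd hw M.nil_notMem
    refine ⟨i, hi, _, ⟨v, a, hw, rfl⟩, by simpa using hn, (hok i v a).2 ho, ?_⟩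
    have hb := Function.eq_update_iff.2 ⟨h3, h4⟩
    rw [hout]
    ext1
    · exact h1
    · simpa [span] using h2
    · simpa [span] using hb
  · rintro ⟨i, hi, _, ⟨v, a, hw, rfl⟩, hn, ho, rfl⟩
    refine ⟨_, Machine.mem_sem_iff.2 ⟨i, hi, _, hw, by simpa using hn, (hok i v a).1 ho, rfl⟩,
      rfl, ?_, ?_⟩
    · simp [span]
    · rw [hout]
      refine Function.eq_update_iff.1 ?_
      simp [span]

end

/-! ### From machines to automata -/

open Classical in
/-- The mapping that is defined on the range of an embedding. -/
noncomputable def PMap.ofEmbedding {α β W : Type*} [Finite W] (ι : W ↪ α) (g : W → β) : PMap α β :=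
  ⟨fun a => if h : ∃ w, ι w = a then some (g h.choose) else none,
    (Set.finite_range ι).subset fun a ha => by
      by_contra h
      have h' : ¬ ∃ w, ι w = a := h
      simp [h'] at ha⟩

theorem PMap.ofEmbedding_apply {α β W : Type*} [Finite W] (ι : W ↪ α) (g : W → β) (w : W) :
    PMap.ofEmbedding ι g (ι w) = some (g w) := by
  have h : ∃ w', ι w' = ι w := ⟨w, rfl⟩
  refine (dif_pos h).trans ?_
  rw [ι.injective h.choose_spec]

theorem PMap.exists_of_ofEmbedding_eq_some {α β W : Type*} [Finite W] {ι : W ↪ α} {g : W → β}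
    {a : α} {b : β} (h : PMap.ofEmbedding ι g a = some b) : ∃ w, ι w = a ∧ g w = b := by
  by_cases h' : ∃ w, ι w = a
  · obtain ⟨w, rfl⟩ := h'
    rw [PMap.ofEmbedding_apply] at h
    exact ⟨w, rfl, Option.some.inj h⟩
  · have : PMap.ofEmbedding ι g a = none := dif_neg h'
    rw [this] at h
    cases h

theorem Set.Finite.exists_embedding_notMem {α W : Type*} [Infinite α] [Finite W] {s : Set α}
    (hs : s.Finite) : ∃ ι : W ↪ α, ∀ w, ι w ∉ s := by
  have : Infinite ↥sᶜ := hs.infinite_compl.to_subtype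
  obtain ⟨n, ⟨e⟩⟩ := Finite.exists_equiv_fin W
  exact ⟨((e.toEmbedding.trans Fin.valEmbedding).trans (_root_.Infinite.natEmbedding _)).trans
    (.subtype (· ∈ sᶜ)), fun w =>
    Subtype.prop ((_root_.Infinite.natEmbedding ↥sᶜ) (e w))⟩

section

variable {A : Type u} {D T X : Type*} {k : ℕ} {𝒮 : Setting A D T X k}
  {Preds : Set (Set (Event A D))}

open ComplexEvent

/-- The expressions `s` and `u` are substituted for registers and inputs. The bound on the
attributes is what later shows that assignments read only defined attributes. -/
theorem Setting.Expressible.exists_expr {V : Type*} {g : (V → D) → (A → D) → D}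
    (hg : 𝒮.Expressible g) (s : V → AExpr A D k) (u : A → AExpr A D k) :
    ∃ α : AExpr A D k, (∀ a ∈ α.att, (∃ v, a ∈ (s v).att) ∨ ∃ b, a ∈ (u b).att) ∧
      ∀ e, 𝒮.eval e α = g (fun v => 𝒮.eval e (s v)) fun a => 𝒮.eval e (u a) := by
  induction hg with
  | const d => exact ⟨.const d, fun _ h => h.elim, fun _ => rfl⟩
  | reg v => exact ⟨s v, fun a h => Or.inl ⟨v, h⟩, fun _ => rfl⟩
  | attr b => exact ⟨u b, fun a h => Or.inr ⟨b, h⟩, fun _ => rfl⟩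
  | op i _ _ ih₁ ih₂ =>
    obtain ⟨α, hα, hα'⟩ := ih₁
    obtain ⟨β, hβ, hβ'⟩ := ih₂
    exact ⟨.op i α β, fun a h => h.elim (hα a) (hβ a), fun e => by
      rw [Setting.eval, hα', hβ']⟩

/-- If register `v` is stored in attribute `ι v`, a register test becomes an event test after the
renaming `r.map ι`. The closure properties of `Preds` do the rest. -/
theorem Testable.exists_pred (hPreds : 𝒮.IsPredicateFamily Preds) {V : Type*}
    {p : Set ((V → D) × ℕ)} (hp : Testable Preds p) (ι : V → A) :
    ∃ P : Preds, ∀ e : Event A D, e ∈ P.1 ↔ (fun v => 𝒮.val e (ι v), e.time) ∈ p := by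
  induction hp with
  | univ => exact ⟨⟨_, hPreds.univ_mem⟩, fun _ => Iff.rfl⟩
  | @event P hP r =>
    refine ⟨⟨_, hPreds.rename_mem _ hP (r.map ι)⟩, fun e => ?_⟩
    change 𝒮.rename (r.map ι) e ∈ P ↔ _
    rw [Setting.rename, PMap.map_map]
    rfl
  | eq v w => exact ⟨⟨_, hPreds.eq_mem (ι v) (ι w)⟩, fun _ => Iff.rfl⟩
  | inter _ _ ihp ihq =>
    obtain ⟨P, hP⟩ := ihp
    obtain ⟨Q, hQ⟩ := ihq
    exact ⟨⟨_, hPreds.inter_mem _ P.2 _ Q.2⟩, fun e => and_congr (hP e) (hQ e)⟩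
  | compl _ ih =>
    obtain ⟨P, hP⟩ := ih
    exact ⟨⟨_, hPreds.compl_mem _ P.2⟩, fun e => not_congr (hP e)⟩

theorem Testable.reg_eq_type (hPreds : 𝒮.IsPredicateFamily Preds) {V : Type*} (v : V) (R : T) :
    Testable Preds {x : (V → D) × ℕ | x.1 v = 𝒮.tyVal R} := by
  have := Testable.event (hPreds.type_mem R)
    ((PMap.idOn {𝒮.typeAttr} (Set.finite_singleton _)).map fun _ => v)
  simpa [Setting.val, PMap.idOn_of_mem _ (Set.mem_singleton 𝒮.typeAttr)] using this

theorem Setting.val_of_data_eq_some {e : Event A D} {a : A} {d : D} (h : e.data a = some d) :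
    𝒮.val e a = d := by
  rw [Setting.val, h, Option.getD_some]

theorem Event.update_data_of_mem {e ν : Event A D} {a : A} (h : a ∈ e.att) :
    (e.update ν).data a = e.data a := by
  change (e.data a).or (ν.data a) = e.data a
  obtain ⟨d, hd⟩ := Option.isSome_iff_exists.1 (show (e.data a).isSome from h)
  rw [hd, Option.some_or]

theorem Event.update_data_of_notMem {e ν : Event A D} {a : A} (h : a ∉ e.att) :
    (e.update ν).data a = ν.data a := by
  change (e.data a).or (ν.data a) = ν.data a
  rw [Option.not_isSome_iff_eq_none.1 h, Option.none_or]

open Classical in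
/-- The expression for the value of an attribute of an event of type `R`. -/
noncomputable def Setting.attExpr (𝒮 : Setting A D T X k) (Sch : T → Finset A) (R : T)
    (a : A) : AExpr A D k :=
  -- An attribute outside the type may be undefined or may hold a register, so it must not be read;
  -- its input value is `NULL`.
  if a ∈ 𝒮.typeAtts Sch R then .attr a else .const 𝒮.null

namespace Machine

variable (M : Machine 𝒮 Preds) (Sch : T → Finset A) (ι : Option M.Reg ↪ A) {σ : Type}

/-- The expression for the register `v`: its initial value in the initial state of the automaton,
and the attribute for `v` otherwise. -/
def regExpr (q : Option σ) (v : M.Reg) : AExpr A D k :=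
  q.elim (.const (M.init v)) fun _ => .attr (ι (some v))

/-- The expression for the update of the register `v`. -/
noncomputable def updExpr (a : M.Letter) (R : T) (q : Option σ) (v : M.Reg) : AExpr A D k :=
  (((M.instr a).expressible v).exists_expr (M.regExpr ι q) (𝒮.attExpr Sch R)).choose

/-- The assignment that executes an instruction and stores the event type. -/
noncomputable def asg (a : M.Letter) (R : T) (q : Option σ) : Assignment A D k :=
  PMap.ofEmbedding ι fun w => w.elim (.attr 𝒮.typeAttr) (M.updExpr Sch ι a R q)

theorem exists_pred (hPreds : 𝒮.IsPredicateFamily Preds) (a : M.Letter) (R : T) :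
    ∃ P : Preds, ∀ e : Event A D, e ∈ P.1 ↔
      (fun v => 𝒮.val e (ι (some v)), e.time) ∈ (M.instr a).pred ∧
        𝒮.val e (ι none) = 𝒮.tyVal R :=
  Testable.exists_pred hPreds (((M.instr a).testable.comap some).and
    (Testable.reg_eq_type hPreds none R)) ι

/-- The transition of the automaton for the letter `a`, the event type `R`, and the state `q`. -/
noncomputable def transition (hPreds : 𝒮.IsPredicateFamily Preds) (N : DFA M.Letter σ)
    (x : M.Letter × T × Option σ) : Transition A D X k Preds (Option σ) where
  src := x.2.2
  asg := M.asg Sch ι x.1 x.2.1 x.2.2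
  pred := (M.exists_pred ι hPreds x.1 x.2.1).choose
  out Z := ((M.instr x.1).out Z).map (PMap.map fun v => ι (some v))
  -- The state `none` stands for `N.start` before anything is read and is never entered again. It is
  -- thus the only state with undefined registers.
  dst := some (N.step (x.2.2.getD N.start) x.1)

/-- The automaton for a machine. -/
noncomputable def acea [Finite T] [Finite σ] (hPreds : 𝒮.IsPredicateFamily Preds)
    (N : DFA M.Letter σ) : ACEA A D X k Preds where
  State := Option σ
  finite_state := inferInstance
  trans := Set.range (M.transition Sch ι hPreds N)
  finite_trans := Set.finite_range _
  initial := none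
  final := some '' N.accept
  consistent := by
    rintro _ ⟨x, rfl⟩ Z r hr a b h
    obtain ⟨r, -, rfl⟩ := Multiset.mem_map.1 hr
    obtain ⟨v, -, rfl⟩ := Option.map_eq_some_iff.1 (show (r a).map _ = some b from h)
    change ((M.asg Sch ι x.1 x.2.1 x.2.2) (ι (some v))).isSome
    rw [asg, PMap.ofEmbedding_apply]
    rfl

/-- The event `ν` stores the register values `ρ`, if the automaton is not in the initial state. -/
def Stores (q : Option σ) (ν : Event A D) (ρ : M.Reg → D) : Prop :=
  (q = none → ρ = M.init) ∧ (q ≠ none → ∀ v, ν.data (ι (some v)) = some (ρ v))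

/-! ### Correctness of the automaton for a machine -/

variable {M Sch ι} {S : List (Event A D)}
  {j : ℕ} {e ν : Event A D} {q : Option σ} {ρ : M.Reg → D} {a : M.Letter} {R : T}

theorem assign_asg_data (ν : Event A D) (w : Option M.Reg) :
    (𝒮.assign (M.asg Sch ι a R q) ν).data (ι w) =
      some (𝒮.eval ν (w.elim (.attr 𝒮.typeAttr) (M.updExpr Sch ι a R q))) := by
  change ((M.asg Sch ι a R q) (ι w)).map _ = _
  rw [asg, PMap.ofEmbedding_apply, Option.map_some]

/-- The copied type is the true one whether or not the guess `R` is right; this is why the predicate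
can check the guess. -/
theorem val_assign_asg_none (hsat : 𝒮.Satisfies Sch e) :
    𝒮.val (𝒮.assign (M.asg Sch ι a R q) (e.update ν)) (ι none) = 𝒮.val e 𝒮.typeAttr := by
  rw [Setting.val_of_data_eq_some (assign_asg_data _ none)]
  obtain ⟨R', -, h⟩ := hsat
  have ht : 𝒮.typeAttr ∈ e.att := h ▸ 𝒮.typeAttr_mem_typeAtts Sch R'
  change 𝒮.val (e.update ν) 𝒮.typeAttr = _
  rw [Setting.val, Event.update_data_of_mem ht, Setting.val]

theorem eval_regExpr (hι : ∀ w R, ι w ∉ 𝒮.typeAtts Sch R)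
    (hst : M.Stores ι q ν ρ) (hatt : e.att = 𝒮.typeAtts Sch R) (v : M.Reg) :
    𝒮.eval (e.update ν) (M.regExpr ι q v) = ρ v := by
  cases q with
  | none => rw [hst.1 rfl]; rfl
  | some q =>
    refine Setting.val_of_data_eq_some ?_
    -- The update prefers the values of `e`; a register survives because its attribute does not
    -- occur in `e`.
    rw [Event.update_data_of_notMem (hatt ▸ hι _ R)]
    exact hst.2 (Option.some_ne_none q) v

theorem eval_attExpr (hatt : e.att = 𝒮.typeAtts Sch R) (b : A) :
    𝒮.eval (e.update ν) (𝒮.attExpr Sch R b) = 𝒮.val e b := by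
  by_cases h : b ∈ 𝒮.typeAtts Sch R
  · rw [Setting.attExpr, if_pos h]
    change 𝒮.val (e.update ν) b = _
    rw [Setting.val, Event.update_data_of_mem (hatt ▸ h), Setting.val]
  · rw [Setting.attExpr, if_neg h, Setting.val]
    rw [← hatt] at h
    rw [Option.not_isSome_iff_eq_none.1 h]
    rfl

theorem assign_asg_data_some (hι : ∀ w R, ι w ∉ 𝒮.typeAtts Sch R)
    (hst : M.Stores ι q ν ρ) (hatt : e.att = 𝒮.typeAtts Sch R)
    (v : M.Reg) : (𝒮.assign (M.asg Sch ι a R q) (e.update ν)).data (ι (some v)) =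
      some ((M.instr a).upd ρ (𝒮.val e) v) := by
  rw [assign_asg_data, Option.elim_some, updExpr,
    (((M.instr a).expressible v).exists_expr (M.regExpr ι q) (𝒮.attExpr Sch R)).choose_spec.2]
  simp only [eval_regExpr hι hst hatt, eval_attExpr hatt]

theorem attIn_asg_subset (hst : M.Stores ι q ν ρ) (hatt : e.att = 𝒮.typeAtts Sch R) :
    Assignment.attIn (M.asg Sch ι a R q) ⊆ (e.update ν).att := by
  have he : ∀ b ∈ 𝒮.typeAtts Sch R, b ∈ (e.update ν).att := fun b hb => by
    rw [← hatt] at hb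
    change ((e.update ν).data b).isSome
    rw [Event.update_data_of_mem hb]
    exact hb
  rintro b ⟨c, α, hc, hb⟩
  obtain ⟨w, rfl, rfl⟩ := PMap.exists_of_ofEmbedding_eq_some hc
  rcases w with _ | v
  · cases (show b = 𝒮.typeAttr from hb)
    exact he _ (𝒮.typeAttr_mem_typeAtts Sch R)
  · rcases (((M.instr a).expressible v).exists_expr (M.regExpr ι q)
      (𝒮.attExpr Sch R)).choose_spec.1 b hb with ⟨v', h⟩ | ⟨b', h⟩
    · cases q with
      | none => exact h.elim
      | some q =>
        cases (show b = ι (some v') from h)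
        change ((e.data (ι (some v'))).or (ν.data (ι (some v')))).isSome
        rw [hst.2 (Option.some_ne_none q) v']
        simp
    · by_cases hb' : b' ∈ 𝒮.typeAtts Sch R
      · rw [Setting.attExpr, if_pos hb'] at h
        cases (show b = b' from h)
        exact he _ hb'
      · rw [Setting.attExpr, if_neg hb'] at h
        exact h.elim

theorem assign_asg_mem_pred_iff (hι : ∀ w R, ι w ∉ 𝒮.typeAtts Sch R)
    (hPreds : 𝒮.IsPredicateFamily Preds) (N : DFA M.Letter σ)
    (hsat : 𝒮.Satisfies Sch e) (hst : M.Stores ι q ν ρ) :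
    𝒮.assign (M.asg Sch ι a R q) (e.update ν) ∈ (M.transition Sch ι hPreds N (a, R, q)).pred.1 ↔
      ((M.instr a).upd ρ (𝒮.val e), e.time) ∈ (M.instr a).pred ∧
        𝒮.val e 𝒮.typeAttr = 𝒮.tyVal R := by
  refine ((M.exists_pred ι hPreds a R).choose_spec _).trans ?_
  rw [val_assign_asg_none hsat]
  -- Only a correct guess of the type ensures that the assignment computes the register values of
  -- the machine.
  refine and_congr_left fun hR => ?_
  have h : (fun v => 𝒮.val (𝒮.assign (M.asg Sch ι a R q) (e.update ν)) (ι (some v))) =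
      (M.instr a).upd ρ (𝒮.val e) :=
    funext fun v => Setting.val_of_data_eq_some
      (assign_asg_data_some hι hst (hsat.att_eq hR) v)
  rw [h]
  rfl

theorem map_rename_out (hι : ∀ w R, ι w ∉ 𝒮.typeAtts Sch R)
    (hst : M.Stores ι q ν ρ) (hatt : e.att = 𝒮.typeAtts Sch R)
    (hPreds : 𝒮.IsPredicateFamily Preds) (N : DFA M.Letter σ) (Z : X) :
    ((M.transition Sch ι hPreds N (a, R, q)).out Z).map (fun r =>
      (⟨(𝒮.rename r (𝒮.assign (M.asg Sch ι a R q) (e.update ν))).data, j⟩ : Event A D)) =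
      (M.instr a).emit ((M.instr a).upd ρ (𝒮.val e)) j Z := by
  rw [transition, Multiset.map_map, Instr.emit]
  refine Multiset.map_congr rfl fun r _ => ?_
  simp only [Function.comp_def, Setting.rename, PMap.map_map]
  congr 3
  funext v
  exact Setting.val_of_data_eq_some (assign_asg_data_some hι hst hatt v)

theorem output_append_singleton (i : ℕ) (w : List M.Letter) (a : M.Letter) :
    M.output S i (w ++ [a]) = fun Z => M.output S i w Z + (M.instr a).emit ((M.instr a).upd
      (Instr.mem (𝒮.inputs S) i M.init (w.map M.instr)) (𝒮.inputs S (i + w.length)))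
      (i + w.length) Z := by
  funext Z
  simp only [Machine.output, List.map_append, Instr.output_append, List.length_map, List.map_cons,
    List.map_nil, Instr.output, add_zero, Pi.add_apply]

variable [Finite T] [Finite σ] {hPreds : 𝒮.IsPredicateFamily Preds} {N : DFA M.Letter σ} {i : ℕ}

/-- The invariant linking runs and words. The bounds on positions come from the events that were
read, so an empty run provides none. -/
theorem exists_word_of_run (hι : ∀ w R, ι w ∉ 𝒮.typeAtts Sch R)
    (hS : 𝒮.IsStream Sch S) {q : (M.acea Sch ι hPreds N).State} {μ : X → Multiset (Event A D)}
    (h : 𝒮.Run (M.acea Sch ι hPreds N) S i j q ν μ) :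
    ∃ w, j = i + w.length ∧ N.eval w = Option.getD (α := σ) q N.start ∧ M.Ok S i w ∧
      μ = M.output S i w ∧
      M.Stores (σ := σ) ι q ν (Instr.mem (𝒮.inputs S) i M.init (w.map M.instr)) ∧
      (w ≠ [] → 1 ≤ i ∧ j ≤ S.length + 1) := by
  induction h with
  | start => exact ⟨[], rfl, rfl, trivial, rfl, ⟨fun _ => rfl, fun h => absurd rfl h⟩,
      fun h => absurd rfl h⟩
  | @step j ν e μ t _ ht he hin hpred ih =>
    obtain ⟨⟨a, R, q⟩, rfl⟩ := ht
    obtain ⟨w, rfl, hq, hok, rfl, hst, hi⟩ := ih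
    obtain ⟨hsat, htime⟩ := hS _ e he
    have hp := (assign_asg_mem_pred_iff hι hPreds N hsat hst).1 hpred
    have hatt := hsat.att_eq hp.2
    refine ⟨w ++ [a], by simp [add_assoc], ?_, ?_, ?_, ?_, ?_⟩
    · rw [DFA.eval_append_singleton, hq]
      rfl
    · rw [Machine.Ok, List.map_append, Instr.ok_append]
      refine ⟨hok, ?_, trivial⟩
      rw [List.length_map, he.inputs_eq, ← htime]
      exact htime ▸ hp.1
    · rw [output_append_singleton, he.inputs_eq]
      exact funext fun Z => congrArg₂ (· + ·) rfl (map_rename_out hι hst hatt hPreds N Z)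
    · refine ⟨fun h => absurd h (Option.some_ne_none _), fun _ v => ?_⟩
      refine (assign_asg_data_some hι hst hatt v).trans ?_
      simp only [List.map_append, Instr.mem_append, List.length_map, List.map_cons, List.map_nil,
        Instr.mem, he.inputs_eq]
    · intro _
      have := he.le_length
      refine ⟨?_, by omega⟩
      by_cases h : w = []
      · have := he.1
        rwa [h] at this
      · exact (hi h).1

theorem exists_run (hι : ∀ w R, ι w ∉ 𝒮.typeAtts Sch R)
    (hS : 𝒮.IsStream Sch S) (hi : 1 ≤ i) (w : List M.Letter)
    (hw : i + w.length ≤ S.length + 1) (hok : M.Ok S i w) :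
    ∃ q ν, (w ≠ [] → q = some (N.eval w)) ∧ (w = [] → q = none) ∧
      M.Stores ι q ν (Instr.mem (𝒮.inputs S) i M.init (w.map M.instr)) ∧
      𝒮.Run (M.acea Sch ι hPreds N) S i (i + w.length) q ν (M.output S i w) := by
  induction w using List.reverseRecOn with
  | nil => exact ⟨none, _, fun h => absurd rfl h, fun _ => rfl,
      ⟨fun _ => rfl, fun h => absurd rfl h⟩, .start⟩
  | append_singleton w a ih =>
    rw [List.length_append, List.length_singleton] at hw
    rw [Machine.Ok, List.map_append, Instr.ok_append] at hok
    obtain ⟨q, ν, hq, hq', hst, hrun⟩ := ih (by omega) hok.1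
    obtain ⟨e, he⟩ := exists_eventAt (S := S) (i := i + w.length) (by omega) (by omega)
    obtain ⟨hsat, htime⟩ := hS _ e he
    -- The run takes the transition that guesses the actual type of the event.
    obtain ⟨R, hR, hatt⟩ := hsat
    have hp : ((M.instr a).upd (Instr.mem (𝒮.inputs S) i M.init (w.map M.instr)) (𝒮.val e),
        e.time) ∈ (M.instr a).pred := by
      have := hok.2.1
      rwa [List.length_map, he.inputs_eq, ← htime] at this
    have hqN : q.getD N.start = N.eval w := by
      by_cases h : w = []
      · rw [hq' h, h]
        rfl
      · rw [hq h]
        rfl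
    have hrun' := Setting.Run.step (𝒜 := M.acea Sch ι hPreds N)
      (t := M.transition Sch ι hPreds N (a, R, q)) hrun ⟨_, rfl⟩ he
      (attIn_asg_subset hst hatt)
      ((assign_asg_mem_pred_iff hι hPreds N ⟨R, hR, hatt⟩ hst).2
        ⟨hp, Setting.val_of_data_eq_some hR⟩)
    refine ⟨some (N.step (q.getD N.start) a), 𝒮.assign (M.asg Sch ι a R q) (e.update ν),
      fun _ => ?_, fun h => by simp at h, ?_, ?_⟩
    rotate_right
    · have hout : M.output S i (w ++ [a]) = fun Z => M.output S i w Z +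
          ((M.transition Sch ι hPreds N (a, R, q)).out Z).map (fun r => (⟨(𝒮.rename r
            (𝒮.assign (M.asg Sch ι a R q) (e.update ν))).data, i + w.length⟩ : Event A D)) := by
        rw [output_append_singleton, he.inputs_eq]
        exact funext fun Z => congrArg₂ (· + ·) rfl (map_rename_out hι hst hatt hPreds N Z).symm
      rw [hout, List.length_append]
      exact hrun'
    · rw [DFA.eval_append_singleton, ← hqN]
    · refine ⟨fun h => absurd h (Option.some_ne_none _), fun _ v => ?_⟩
      refine (assign_asg_data_some hι hst hatt v).trans ?_
      simp only [List.map_append, Instr.mem_append, List.length_map, List.map_cons, List.map_nil,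
        Instr.mem, he.inputs_eq]

end Machine

theorem Definable.exists_acea [Infinite A] [Finite T] (hPreds : 𝒮.IsPredicateFamily Preds)
    {Sch : T → Finset A} {F : List (Event A D) → Set (ComplexEvent A D X)}
    (hF : Definable 𝒮 Preds Sch F) :
    ∃ 𝒜 : ACEA A D X k Preds, ∀ S, 𝒮.IsStream Sch S → F S = 𝒮.accepted 𝒜 S := by
  obtain ⟨M, hM⟩ := hF
  obtain ⟨σ, _, N, hN⟩ := M.regular
  -- One fresh attribute for each register, and one, at `none`, for the copy of the event type.
  obtain ⟨ι, hι⟩ := (Set.finite_iUnion fun R => 𝒮.finite_typeAtts Sch R).exists_embedding_notMem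
    (W := Option M.Reg)
  have hι' : ∀ w R, ι w ∉ 𝒮.typeAtts Sch R := fun w R h => hι w (Set.mem_iUnion.2 ⟨R, h⟩)
  refine ⟨M.acea Sch ι hPreds N, fun S hS => ?_⟩
  rw [← hM S hS]
  ext C
  constructor
  · rintro ⟨h1, h2, w, hw, hl, hok, hout⟩
    have hpos := M.length_pos hw
    obtain ⟨q, ν, hq, -, -, hrun⟩ := Machine.exists_run (hPreds := hPreds) (N := N) hι' hS h1 w
      (by omega) hok
    rw [hq (List.length_pos_iff.1 hpos), ← hl, ← hout] at hrun
    refine ⟨by omega, _, ⟨N.eval w, ?_, rfl⟩, ν, hrun⟩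
    rw [← hN] at hw
    exact hw
  · rintro ⟨hle, _, ⟨q, hq, rfl⟩, ν, hrun⟩
    obtain ⟨w, hl, hw, hok, hout, -, hlen⟩ := Machine.exists_word_of_run hι' hS hrun
    have hne : w ≠ [] := by
      rintro rfl
      simp only [List.length_nil] at hl
      omega
    obtain ⟨h1, hlen'⟩ := hlen hne
    refine ⟨h1, by omega, w, ?_, hl, hok, hout⟩
    rw [← hN]
    change N.eval w ∈ N.accept
    rw [hw]
    exact hq

end

/-! ### The theorem, by induction on the formula -/

theorem mainTheorem1 {A D T X : Type*} [Infinite A] [Fintype X] {k : ℕ}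
    (𝒮 : Setting A D T X k) (Preds : Set (Set (Event A D))) (hPreds : 𝒮.IsPredicateFamily Preds)
    (Sch : T → Finset A) (φ : ACEL A D T X k Preds) :
    ∃ 𝒜 : ACEA A D X k Preds, ∀ S : List (Event A D), 𝒮.IsStream Sch S →
      𝒮.sem S φ = 𝒮.accepted 𝒜 S := by
  -- Event types are variables, so there are finitely many. Hence the schema uses finitely many
  -- attributes, and guessing the type takes finitely many transitions.
  have : Finite T := Finite.of_injective _ 𝒮.tyVar.injective
  refine Definable.exists_acea hPreds ?_
  induction φ with
  | ty R => exact definable_ty hPreds Sch R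
  | as φ Z ih => exact ih.as Z
  | filter φ Z P ih => exact ih.filter Z P.2
  | proj L φ ih => exact ih.proj L
  | or φ₁ φ₂ ih₁ ih₂ => exact ih₁.union ih₂
  | and φ₁ φ₂ ih₁ ih₂ => exact ih₁.inter ih₂
  | cseq φ₁ φ₂ ih₁ ih₂ =>
    have := ih₁.link ih₂ isGap_zero
    rwa [ComplexEvent.link_zero] at this
  | seq φ₁ φ₂ ih₁ ih₂ =>
    have := ih₁.link ih₂ isGap_univ
    rwa [ComplexEvent.link_univ] at this
  | citer φ ih =>
    have := ih.iter isGap_zero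
    rwa [ComplexEvent.link_zero] at this
  | iter φ ih =>
    have := ih.iter isGap_univ
    rwa [ComplexEvent.link_univ] at this
  | attProj Z s φ ih => exact ih.attProj Z s
  | agg Y s φ ih => exact ih.agg Y s
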